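/- **Model.** In the Congested Clique, $n$ nodes with identifiers $1,\dots,n$ compute in synchronous rounds; in each round every node may send a message of $O(\log n)$ bits to each other node. Local computation is unrestricted, and in randomized algorithms each node has private random bits. The input is a simple undirected graph $G=(V,E)$, $|V|=n$, whose edge weights are positive integers bounded by $n^{p}$ for a constant $p$; each node initially knows its incident edges and their weights. Let $d=d_G$ be the weighted distance ($\infty$ between different components). For $\alpha\ge 1$, an $\alpha$-approximation of APSP on a graph $H$ is a function $f$ with $d_H(u,v)\le f(u,v)\le\alpha\, d_H(u,v)$ for all nodes $u,v$ of $H$, where each node $u$ knows the values $f(u,\cdot)$. With high probability (w.h.p.) means with probability at least $1-n^{-c}$, where $c$ is an arbitrary constant; the constants in the round bounds, in the message size and in the exponent bounding the weights of $G_S$ below may depend on $p$ and $c$ only, and the constant in the bound on $|V_S|$ is absolute. **Lemma 6.1 (Skeleton graphs).** Let $a\ge 1$ be a real number and $k\ge 1$ an integer. Let $\delta$ be a symmetric integer-valued function on pairs of nodes of $G$. Suppose that each node $u$ is given a set $\tilde N_k(u)$ of $k$ nodes such that * for each $v\in\tilde N_k(u)$, the value $\delta(u,v)$ is known to $u$ and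 $d(u,v)\le\delta(u,v)\le a\cdot d(u,v)$; * for all $v\in\tilde N_k(u)$ and $t\notin\tilde N_k(u)$, $\delta(u,v)\le a\cdot d(u,t)$. Then there is a randomized $O(1)$-round algorithm and a deterministic $O(1)$-round algorithm, both depending only on $n$, $k$, $p$, $c$, such that w.h.p. the following holds. The randomized algorithm constructs a weighted undirected graph $G_S$, with positive integer edge weights polynomially bounded in $n$, over a subset $V_S\subseteq V$ of size $$|V_S| = O\!\left(\frac{n\log(k+1)}{k}\right);$$ each node learns whether it belongs to $V_S$ and learns its incident edges in $G_S$ with their weights. Moreover, for every real $l\ge 1$ and every $l$-approximation $\delta_{G_S}$ of APSP on $G_S$, if each node $s\in V_S$ is given the values $\delta_{G_S}(s,\cdot)$ on $V_S$, then the deterministic algorithm computes a $7la^2$-approximation of APSP on $G$. -/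

import Mathlib

open scoped ENNReal

/-! ### Weighted graphs and distances -/

/-- A simple undirected graph with positive integer edge weights. The value of `weight` at a pair
that is not an edge plays no role. -/
structure WGraph (V : Type) where
  graph : SimpleGraph V
  weight : Sym2 V → ℕ
  weight_pos : ∀ e ∈ graph.edgeSet, 0 < weight e

namespace WGraph

variable {V : Type}

/-- The weighted distance: the least total weight of a walk from `u` to `v`, and `⊤` if there is
none. (Weights being positive, walks and paths give the same minimum.) -/
noncomputable def dist (G : WGraph V) (u v : V) : ℕ∞ :=
  ⨅ p : G.graph.Walk u v, (((p.edges.map G.weight).sum : ℕ) : ℕ∞)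

/-- All edge weights are at most `M`. -/
def WeightsLE (G : WGraph V) (M : ℕ) : Prop :=
  ∀ e ∈ G.graph.edgeSet, G.weight e ≤ M

/-- `G` is a graph over the node set `S`: both endpoints of every edge lie in `S`. -/
def IsOver (G : WGraph V) (S : Finset V) : Prop :=
  ∀ u v, G.graph.Adj u v → u ∈ S ∧ v ∈ S

open Classical in
/-- The incident edges of `v` together with their weights (`none` means that there is no edge). -/
noncomputable def incident (G : WGraph V) (v : V) : V → Option ℕ :=
  fun u => if G.graph.Adj v u then some (G.weight s(v, u)) else none

end WGraph

/-- `f` is an `α`-approximation of the distances `d` between the nodes of `S`: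
`d u v ≤ f u v ≤ α * d u v` for all `u, v ∈ S`. -/
def IsApproxOn {V : Type} (S : Finset V) (α : ℝ) (d : V → V → ℕ∞) (f : V → V → ℝ≥0∞) : Prop :=
  ∀ u ∈ S, ∀ v ∈ S, (d u v : ℝ≥0∞) ≤ f u v ∧ f u v ≤ ENNReal.ofReal α * (d u v : ℝ≥0∞)

/-! ### The congested clique -/

namespace CongestedClique

/-- A message: a string of `β * (⌊log₂ n⌋ + 1)` bits. -/
abbrev Msg (n β : ℕ) : Type := Fin (β * (Nat.log 2 n + 1)) → Bool

/-- A deterministic algorithm for the congested clique on the nodes `Fin n`, with local inputs in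
`In` and local outputs in `Out`. In a round every node sends one message to every node, as a
function of its own local state, and then updates its state from the messages it received. Local
computation is unrestricted; every node knows its own identifier and `n`. -/
structure Algorithm (n β : ℕ) (In Out : Type) where
  State : Type
  init : Fin n → In → State
  /-- `send u s v` is the message from `u`, in state `s`, to `v`. -/
  send : Fin n → State → Fin n → Msg n β
  /-- `step v s m` is the new state of `v` when `m u` is the message received from `u`. -/
  step : Fin n → State → (Fin n → Msg n β) → State
  output : Fin n → State → Out

namespace Algorithm

variable {n β : ℕ} {In Out : Type}

/-- The local states after a given number of rounds, on the local inputs `x`. -/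
def stateAfter (A : Algorithm n β In Out) (x : Fin n → In) : ℕ → Fin n → A.State
  | 0 => fun v => A.init v (x v)
  | R + 1 => fun v => A.step v (A.stateAfter x R v) (fun u => A.send u (A.stateAfter x R u) v)

/-- The local outputs when `A` is run for `R` rounds on the local inputs `x`. -/
def run (A : Algorithm n β In Out) (R : ℕ) (x : Fin n → In) (v : Fin n) : Out :=
  A.output v (A.stateAfter x R v)

end Algorithm

/-- The probability of `P` when each of the `n` nodes independently draws `r` private uniformly
random bits; `ω v` are the bits of node `v`. -/
noncomputable def coinProb (n r : ℕ) (P : (Fin n → Fin r → Bool) → Prop) : ℝ :=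
  (Nat.card {ω : Fin n → Fin r → Bool // P ω} : ℝ) / (Nat.card (Fin n → Fin r → Bool) : ℝ)

end CongestedClique

/-! ### Approximate nearest sets and local inputs and outputs -/

/-- The sets `N u` are approximate nearest sets and `δ` is a local `a`-approximation of the
distances of `G`, that is,
* `d u v ≤ δ u v ≤ a * d u v` for all `v ∈ N u`, and
* `δ u v ≤ a * d u t` for all `v ∈ N u` and `t ∉ N u`.

(The first inequality forces `δ u v` to be nonnegative, so that it may be read as a natural number;
it also forces `d u v` to be finite.) -/
structure IsLocalApprox {V : Type} (G : WGraph V) (a : ℝ) (δ : V → V → ℤ) (N : V → Finset V) :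
    Prop where
  nonneg : ∀ u, ∀ v ∈ N u, 0 ≤ δ u v
  lower : ∀ u, ∀ v ∈ N u, (G.dist u v : ℝ≥0∞) ≤ ((δ u v).toNat : ℝ≥0∞)
  upper : ∀ u, ∀ v ∈ N u, ((δ u v).toNat : ℝ≥0∞) ≤ ENNReal.ofReal a * (G.dist u v : ℝ≥0∞)
  far : ∀ u, ∀ v ∈ N u, ∀ t, t ∉ N u →
    ((δ u v).toNat : ℝ≥0∞) ≤ ENNReal.ofReal a * (G.dist u t : ℝ≥0∞)

/-- What a node knows initially: its incident edges, its approximate nearest set, and the value of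
`δ` at the members of that set only. -/
structure LocalInput (n : ℕ) where
  edges : Fin n → Option ℕ
  near : Finset (Fin n)
  est : Fin n → Option ℤ

/-- The local input of the node `v`. -/
noncomputable def localInput {n : ℕ} (G : WGraph (Fin n)) (δ : Fin n → Fin n → ℤ)
    (N : Fin n → Finset (Fin n)) (v : Fin n) : LocalInput n where
  edges := G.incident v
  near := N v
  est := fun u => if u ∈ N v then some (δ v u) else none

/-- What a node knows about a skeleton graph: whether it is a node of it, and its incident edges
in it. -/
structure LocalSkeleton (n : ℕ) where
  isNode : Bool
  edges : Fin n → Option ℕ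

/-- The local view, at node `v`, of the weighted graph `H` over the node set `S`. -/
noncomputable def localSkeleton {n : ℕ} (S : Finset (Fin n)) (H : WGraph (Fin n)) (v : Fin n) :
    LocalSkeleton n where
  isNode := decide (v ∈ S)
  edges := H.incident v

/-- What node `v` is given of distance estimates `D` between the nodes of `S`: its own row if
`v ∈ S`, and nothing otherwise. -/
noncomputable def distRow {n : ℕ} (S : Finset (Fin n)) (D : Fin n → Fin n → ℝ≥0∞) (v : Fin n) :
    Fin n → Option ℝ≥0∞ :=
  fun u => if v ∈ S ∧ u ∈ S then some (D v u) else none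

/-!
*The graph.* Take as hubs `S` a random sample of the nodes, each drawn with probability about
`log (k + 1) / k`, together with the nodes whose near sets the sample misses, so that every near set
contains a hub. Order the near set of `x` by estimated distance: the first hub in it is the hub of
`x`, its estimate is the radius `r x`, and the nodes up to it form the ball of `x`. A skeleton edge
leads from the hub of `x` through `x` to a node `z` of its ball, along at most one edge to a node
`y`, and on to the hub of `y`. Where a shortest path from `x` to `v` leaves the ball of `x`, along
an edge `z y` say, `r x` and the length of the skeleton edge are bounded by `3 a` times the part of
the path up to `y`, except for the summand `r y`, which the continuation from `y` absorbs. Hence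
`r x + d_S (hub x) (hub v) ≤ 3 a d x v + (2 a + 1) r v`. If `x` is outside the ball of `v`, then
`r v ≤ a d x v`, so the detour from `x` to `v` over the two hubs costs at most
`l (3 a + a (2 a + 1) + a) d x v ≤ 7 l a² d x v`.

*The rounds.* A ball is a run up to the first sampled node, so its expected size is at most
`k / log (k + 1)`. With probability at least `1 / 2`, the number of hubs times the total size of the
balls is therefore `O(n²)`. This is small enough for the nodes, divided into blocks of one worker
per hub, to receive the contents of all balls in `O(1)` rounds: each ball is first dealt out over
all nodes, with consecutive global numbers on consecutive helpers, and each helper then passes on a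
constant number of items per worker. Among `c log n` independent samples drawn in parallel there is
a good one with high probability.
-/

/-- A length is either infinite or at most `K`: up to `K + 2` values, so that it fits in a
message. -/
def Capped (K : ℕ) (x : ℕ∞) : Prop := x = ⊤ ∨ x ≤ K

namespace Capped

variable {K : ℕ}

theorem mono {K' : ℕ} {x : ℕ∞} (h : K ≤ K') (hx : Capped K x) : Capped K' x :=
  hx.imp_right fun hx => hx.trans (by exact_mod_cast h)

theorem iInf {ι : Sort*} {f : ι → ℕ∞} (h : ∀ i, Capped K (f i)) : Capped K (⨅ i, f i) := by
  by_cases hf : ∀ i, f i = ⊤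
  · exact Or.inl (iInf_eq_top.2 hf)
  · obtain ⟨i, hi⟩ := not_forall.1 hf
    exact Or.inr ((iInf_le f i).trans ((h i).resolve_left hi))

theorem add {K' : ℕ} {x y : ℕ∞} (hx : Capped K x) (hy : Capped K' y) : Capped (K + K') (x + y) := by
  rcases hx with rfl | hx
  · exact Or.inl (top_add y)
  rcases hy with rfl | hy
  · exact Or.inl (add_top x)
  · exact Or.inr (by push_cast; exact add_le_add hx hy)

theorem coe {m : ℕ} (h : m ≤ K) : Capped K m := Or.inr (by exact_mod_cast h)

end Capped

namespace WGraph

variable {V : Type} {G : WGraph V}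

/-- The total weight of a walk. -/
def walkWeight (G : WGraph V) {u v : V} (p : G.graph.Walk u v) : ℕ := (p.edges.map G.weight).sum

@[simp] theorem walkWeight_nil (u : V) : G.walkWeight (.nil : G.graph.Walk u u) = 0 := rfl

@[simp] theorem walkWeight_cons {u v w : V} (h : G.graph.Adj u v) (p : G.graph.Walk v w) :
    G.walkWeight (.cons h p) = G.weight s(u, v) + G.walkWeight p := by
  simp [walkWeight]

@[simp] theorem walkWeight_append {u v w : V} (p : G.graph.Walk u v) (q : G.graph.Walk v w) :
    G.walkWeight (p.append q) = G.walkWeight p + G.walkWeight q := by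
  simp [walkWeight]

@[simp] theorem walkWeight_reverse {u v : V} (p : G.graph.Walk u v) :
    G.walkWeight p.reverse = G.walkWeight p := by
  simp [walkWeight]

theorem dist_le_walkWeight {u v : V} (p : G.graph.Walk u v) : G.dist u v ≤ G.walkWeight p :=
  iInf_le (fun p : G.graph.Walk u v => (G.walkWeight p : ℕ∞)) p

theorem exists_walkWeight_le {u v : V} {m : ℕ} (h : G.dist u v ≤ m) :
    ∃ p : G.graph.Walk u v, G.walkWeight p ≤ m := by
  have hlt : G.dist u v < ((m + 1 : ℕ) : ℕ∞) := h.trans_lt (by exact_mod_cast Nat.lt_succ_self m)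
  obtain ⟨p, hp⟩ := iInf_lt_iff.1 hlt
  exact ⟨p, Nat.lt_succ_iff.1 (by exact_mod_cast hp)⟩

theorem exists_dist_eq_walkWeight {u v : V} (h : G.dist u v ≠ ⊤) :
    ∃ p : G.graph.Walk u v, G.dist u v = G.walkWeight p := by
  obtain ⟨m, hm⟩ := ENat.ne_top_iff_exists.1 h
  obtain ⟨p, hp⟩ := exists_walkWeight_le hm.ge
  exact ⟨p, le_antisymm (dist_le_walkWeight p) (hm ▸ by exact_mod_cast hp)⟩

theorem dist_self (u : V) : G.dist u u = 0 :=
  le_antisymm (dist_le_walkWeight (.nil : G.graph.Walk u u)) zero_le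

theorem dist_comm (u v : V) : G.dist u v = G.dist v u := by
  have dist_le_swap (u v : V) : G.dist u v ≤ G.dist v u := le_iInf fun p =>
    (dist_le_walkWeight p.reverse).trans_eq (congrArg Nat.cast (walkWeight_reverse p))
  exact le_antisymm (dist_le_swap u v) (dist_le_swap v u)

theorem dist_triangle (u v w : V) : G.dist u w ≤ G.dist u v + G.dist v w := by
  by_cases huv : G.dist u v = ⊤
  · simp [huv]
  by_cases hvw : G.dist v w = ⊤
  · simp [hvw]
  obtain ⟨p, hp⟩ := exists_dist_eq_walkWeight huv
  obtain ⟨q, hq⟩ := exists_dist_eq_walkWeight hvw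
  rw [hp, hq]
  simpa using dist_le_walkWeight (p.append q)

theorem eq_of_dist_eq_zero {u v : V} (h : G.dist u v = 0) : u = v := by
  obtain ⟨p, hp⟩ := exists_walkWeight_le (G := G) (m := 0) h.le
  cases p with
  | nil => rfl
  | cons e p =>
    have := G.weight_pos _ ((SimpleGraph.mem_edgeSet _).2 e)
    rw [walkWeight_cons] at hp
    omega

theorem dist_le_weight {u v : V} (h : G.graph.Adj u v) : G.dist u v ≤ G.weight s(u, v) := by
  simpa [SimpleGraph.Adj.toWalk] using dist_le_walkWeight h.toWalk

theorem exists_crossing {P : V → Prop} {u v : V} (p : G.graph.Walk u v) (hu : P u) (hv : ¬ P v) :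
    ∃ (z y : V) (_ : G.graph.Adj z y) (p₁ : G.graph.Walk u z) (p₂ : G.graph.Walk y v),
      P z ∧ ¬ P y ∧ G.walkWeight p = G.walkWeight p₁ + G.weight s(z, y) + G.walkWeight p₂ ∧
      p₂.length < p.length := by
  induction p with
  | nil => exact absurd hu hv
  | @cons u w v h p ih =>
    by_cases hw : P w
    · obtain ⟨z, y, hzy, p₁, p₂, hz, hy, hsum, hlen⟩ := ih hw hv
      refine ⟨z, y, hzy, .cons h p₁, p₂, hz, hy, ?_, ?_⟩
      · simp only [walkWeight_cons, hsum, add_assoc]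
      · exact hlen.trans (Nat.lt_succ_self _)
    · exact ⟨u, w, h, .nil, p, hu, hw, by simp, by simp⟩

theorem capped_dist [Fintype V] {K : ℕ} (hG : G.WeightsLE K) (u v : V) :
    Capped (Fintype.card V * K) (G.dist u v) := by
  classical
  refine or_iff_not_imp_left.2 fun h => ?_
  obtain ⟨p, -⟩ := exists_dist_eq_walkWeight h
  have hweight : G.walkWeight p.bypass ≤ p.bypass.length * K := by
    rw [walkWeight, ← SimpleGraph.Walk.length_edges, ← List.length_map G.weight, ← smul_eq_mul]
    refine List.sum_le_card_nsmul _ K fun x hx => ?_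
    obtain ⟨e, he, rfl⟩ := List.mem_map.1 hx
    exact hG e (p.bypass.edges_subset_edgeSet he)
  refine (dist_le_walkWeight p.bypass).trans ?_
  exact_mod_cast hweight.trans
    (Nat.mul_le_mul_right _ (SimpleGraph.Walk.bypass_isPath p).length_lt.le)

theorem incident_eq_some_iff {u v : V} {w : ℕ} :
    G.incident u v = some w ↔ G.graph.Adj u v ∧ G.weight s(u, v) = w := by
  by_cases h : G.graph.Adj u v <;> simp [incident, h]

end WGraph

/-! ### The skeleton graph of a hub system -/

section Reach

variable {V : Type}

open Classical in
/-- The length of the step from `z` to `y` along at most one edge, when `edges` are the weights of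
the edges incident to `z`. -/
noncomputable def hopLength (edges : V → Option ℕ) (z y : V) : ℕ∞ :=
  if y = z then 0 else (edges y).elim ⊤ (↑)

/-- The length of a shortest connection from `z` to the hub `s` that follows at most one edge and
then goes from the node reached to its hub. -/
noncomputable def reach (hub : V → V) (radius : V → ℕ) (edges : V → Option ℕ) (z s : V) : ℕ∞ :=
  ⨅ (y) (_ : hub y = s), hopLength edges z y + radius y

theorem capped_reach {M : ℕ} {hub : V → V} {radius : V → ℕ} {edges : V → Option ℕ}
    (hradius : ∀ y, radius y ≤ M) (hedges : ∀ y w, edges y = some w → w ≤ M) (z s : V) :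
    Capped (M + M) (reach hub radius edges z s) := by
  refine .iInf fun y => .iInf fun _ => .add ?_ (.coe (hradius y))
  unfold hopLength
  split_ifs
  · exact .coe (Nat.zero_le M)
  · rcases hy : edges y with _ | w
    · exact Or.inl rfl
    · exact .coe (hedges y w hy)

theorem WGraph.hopLength_incident_of_adj {G : WGraph V} {z y : V} (h : G.graph.Adj z y) :
    hopLength (G.incident z) z y = G.weight s(z, y) := by
  rw [hopLength, if_neg h.ne', incident_eq_some_iff.2 ⟨h, rfl⟩, Option.elim_some]

theorem WGraph.dist_le_hopLength (G : WGraph V) (z y : V) :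
    G.dist z y ≤ hopLength (G.incident z) z y := by
  by_cases hyz : y = z
  · simp [hyz, G.dist_self]
  by_cases h : G.graph.Adj z y
  · exact (dist_le_weight h).trans_eq (hopLength_incident_of_adj h).symm
  · simp [hopLength, incident, hyz, h]

end Reach

/-- For every node `x`, a hub, a radius (an estimate of the distance to the hub), the ball of the
nodes up to that radius, and distance estimates from `x` to the nodes of its ball. -/
structure HubSystem (V : Type) where
  hub : V → V
  radius : V → ℕ
  ball : V → Finset V
  est : V → V → ℕ

namespace HubSystem

variable {V : Type} (H : HubSystem V)

/-- The length of a shortest connection between the hubs `s` and `t` that leads from `s` to a node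
`x` with hub `s`, to a node of the ball of `x`, along at most one edge, and to the hub `t` of the
node reached. -/
noncomputable def cost (edges : V → V → Option ℕ) (s t : V) : ℕ∞ :=
  ⨅ (x) (_ : H.hub x = s) (z) (_ : z ∈ H.ball x),
    (H.radius x : ℕ∞) + (H.est x z + reach H.hub H.radius (edges z) z t)

/-- The length of a skeleton edge: the cheaper of the two directions. -/
noncomputable def edgeLength (edges : V → V → Option ℕ) (s t : V) : ℕ∞ :=
  min (H.cost edges s t) (H.cost edges t s)

variable {H}

theorem edgeLength_comm (edges : V → V → Option ℕ) (s t : V) :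
    H.edgeLength edges s t = H.edgeLength edges t s := min_comm _ _

theorem capped_edgeLength {M : ℕ} {edges : V → V → Option ℕ} (hradius : ∀ x, H.radius x ≤ M)
    (hest : ∀ x z, H.est x z ≤ M) (hedges : ∀ z y w, edges z y = some w → w ≤ M) (s t : V) :
    Capped (4 * M) (H.edgeLength edges s t) := by
  have capped_cost (s t : V) : Capped (4 * M) (H.cost edges s t) :=
    .iInf fun x => .iInf fun _ => .iInf fun z => .iInf fun _ =>
      (Capped.add (.coe (hradius x))
        (.add (.coe (hest x z)) (capped_reach hradius (hedges z) z t))).mono (by omega)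
  rcases min_choice (H.cost edges s t) (H.cost edges t s) with h | h <;> rw [edgeLength, h]
  exacts [capped_cost s t, capped_cost t s]

/-- The hubs lie in `S`, the estimates are correct up to the factor `α`, and so is the radius of
`x` as a lower bound for the distances from `x` to `S` and to the complement of its ball. -/
structure IsApprox (H : HubSystem V) (G : WGraph V) (α : ℝ≥0∞) (S : Finset V) : Prop where
  hub_mem : ∀ x, H.hub x ∈ S
  self_mem_ball : ∀ x, x ∈ H.ball x
  dist_hub_le : ∀ x, G.dist x (H.hub x) ≤ H.radius x
  dist_le_est : ∀ x, ∀ z ∈ H.ball x, G.dist x z ≤ H.est x z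
  est_le : ∀ x, ∀ z ∈ H.ball x, (H.est x z : ℝ≥0∞) ≤ α * G.dist x z
  radius_le_of_notMem_ball : ∀ x, ∀ y ∉ H.ball x, (H.radius x : ℝ≥0∞) ≤ α * G.dist x y
  radius_le_of_mem : ∀ x, ∀ s ∈ S, (H.radius x : ℝ≥0∞) ≤ α * G.dist x s

namespace IsApprox

variable {G : WGraph V} {α : ℝ≥0∞} {S : Finset V} (h : H.IsApprox G α S)

include h

theorem dist_le_cost (s t : V) : G.dist s t ≤ H.cost G.incident s t := by
  refine le_iInf fun x => le_iInf fun hx => le_iInf fun z => le_iInf fun hz => ?_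
  have hub_to_center : G.dist s x ≤ H.radius x := by
    rw [G.dist_comm, ← hx]
    exact h.dist_hub_le x
  have dist_le_reach : G.dist z t ≤ reach H.hub H.radius (G.incident z) z t := by
    refine le_iInf fun y => le_iInf fun hy => (G.dist_triangle z y t).trans ?_
    rw [← hy]
    exact add_le_add (G.dist_le_hopLength z y) (h.dist_hub_le y)
  calc G.dist s t ≤ G.dist s x + (G.dist x z + G.dist z t) :=
        (G.dist_triangle s x t).trans (by gcongr; exact G.dist_triangle x z t)
    _ ≤ _ := by gcongr; exact h.dist_le_est x z hz

theorem dist_le_edgeLength (s t : V) : G.dist s t ≤ H.edgeLength G.incident s t :=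
  le_min (h.dist_le_cost s t) (G.dist_comm s t ▸ h.dist_le_cost t s)

/-- The skeleton graph: distinct nodes of `S` are joined by an edge if some connection between them
through a ball and at most one edge exists. -/
noncomputable def skeleton : WGraph V where
  graph :=
    { Adj := fun s t => s ≠ t ∧ s ∈ S ∧ t ∈ S ∧ H.edgeLength G.incident s t ≠ ⊤
      symm := ⟨fun s t ⟨hst, hs, ht, hlt⟩ => ⟨hst.symm, ht, hs, edgeLength_comm _ s t ▸ hlt⟩⟩
      loopless := ⟨fun _ hs => hs.1 rfl⟩ }
  weight := Sym2.lift ⟨fun s t => (H.edgeLength G.incident s t).toNat,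
    fun s t => congrArg _ (edgeLength_comm _ s t)⟩
  weight_pos := by
    rintro ⟨s, t⟩ ⟨hst, -, -, hlt⟩
    refine Nat.pos_of_ne_zero fun hzero => hst (G.eq_of_dist_eq_zero (nonpos_iff_eq_zero.1 ?_))
    calc G.dist s t ≤ H.edgeLength G.incident s t := h.dist_le_edgeLength s t
      _ = ((H.edgeLength G.incident s t).toNat : ℕ∞) := (ENat.natCast_toNat hlt).symm
      _ = 0 := congrArg Nat.cast hzero

theorem skeleton_adj {s t : V} : h.skeleton.graph.Adj s t ↔
    s ≠ t ∧ s ∈ S ∧ t ∈ S ∧ H.edgeLength G.incident s t ≠ ⊤ := Iff.rfl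

theorem skeleton_weight {s t : V} (hst : h.skeleton.graph.Adj s t) :
    (h.skeleton.weight s(s, t) : ℕ∞) = H.edgeLength G.incident s t :=
  ENat.natCast_toNat hst.2.2.2

theorem skeleton_isOver : h.skeleton.IsOver S := fun _ _ hst => ⟨hst.2.1, hst.2.2.1⟩

theorem skeleton_weightsLE {M : ℕ} (hG : G.WeightsLE M) (hradius : ∀ x, H.radius x ≤ M)
    (hest : ∀ x z, H.est x z ≤ M) : h.skeleton.WeightsLE (4 * M) := by
  have hedges (z y : V) (w : ℕ) (hw : G.incident z y = some w) : w ≤ M := by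
    obtain ⟨hzy, rfl⟩ := WGraph.incident_eq_some_iff.1 hw
    exact hG _ hzy
  rintro ⟨s, t⟩ hst
  exact ENat.toNat_le_of_le_natCast
    ((capped_edgeLength hradius hest hedges s t).resolve_left hst.2.2.2)

theorem dist_le_skeleton_dist (s t : V) : G.dist s t ≤ h.skeleton.dist s t := by
  refine le_iInf fun p => ?_
  change G.dist s t ≤ (h.skeleton.walkWeight p : ℕ∞)
  induction p with
  | nil => simp [G.dist_self]
  | @cons u v w e p ih =>
    rw [WGraph.walkWeight_cons, Nat.cast_add, h.skeleton_weight e]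
    exact (G.dist_triangle u v w).trans (add_le_add (h.dist_le_edgeLength u v) ih)

theorem skeleton_dist_le_edgeLength {s t : V} (hs : s ∈ S) (ht : t ∈ S) :
    h.skeleton.dist s t ≤ H.edgeLength G.incident s t := by
  by_cases hst : s = t
  · simp [hst, WGraph.dist_self]
  by_cases hlt : H.edgeLength G.incident s t = ⊤
  · simp [hlt]
  have hadj : h.skeleton.graph.Adj s t := ⟨hst, hs, ht, hlt⟩
  exact (WGraph.dist_le_weight hadj).trans_eq (h.skeleton_weight hadj)

theorem skeleton_dist_hub_le {x z : V} (hz : z ∈ H.ball x) (y : V) :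
    h.skeleton.dist (H.hub x) (H.hub y) ≤
      H.radius x + (H.est x z + (hopLength (G.incident z) z y + H.radius y)) := by
  refine (h.skeleton_dist_le_edgeLength (h.hub_mem x) (h.hub_mem y)).trans
    ((min_le_left _ _).trans ?_)
  refine iInf_le_of_le x (iInf_le_of_le rfl (iInf_le_of_le z (iInf_le_of_le hz ?_)))
  gcongr
  exact iInf_le_of_le y (iInf_le_of_le rfl le_rfl)

theorem radius_add_skeleton_dist_le_of_mem_ball {x v : V} (p : G.graph.Walk x v)
    (hv : v ∈ H.ball x) :
    (H.radius x : ℝ≥0∞) + h.skeleton.dist (H.hub x) (H.hub v) ≤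
      3 * α * G.walkWeight p + (2 * α + 1) * H.radius v := by
  have hradius : (H.radius x : ℝ≥0∞) ≤ α * (G.walkWeight p + H.radius v) := by
    refine (h.radius_le_of_mem x _ (h.hub_mem v)).trans (mul_le_mul_right ?_ _)
    exact_mod_cast (G.dist_triangle x v _).trans
      (add_le_add (WGraph.dist_le_walkWeight p) (h.dist_hub_le v))
  have hest : (H.est x v : ℝ≥0∞) ≤ α * G.walkWeight p :=
    (h.est_le x v hv).trans (mul_le_mul_right (by exact_mod_cast WGraph.dist_le_walkWeight p) _)
  have hdist : (h.skeleton.dist (H.hub x) (H.hub v) : ℝ≥0∞) ≤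
      H.radius x + (H.est x v + H.radius v) := by
    have := h.skeleton_dist_hub_le hv v
    rw [hopLength, if_pos rfl, zero_add] at this
    exact_mod_cast this
  calc _ ≤ (H.radius x : ℝ≥0∞) + (H.radius x + (H.est x v + H.radius v)) := by gcongr
    _ ≤ α * (G.walkWeight p + H.radius v) + (α * (G.walkWeight p + H.radius v) +
        (α * G.walkWeight p + H.radius v)) := by gcongr
    _ = _ := by ring

theorem radius_add_skeleton_dist_le_of_adj (hα : 1 ≤ α) {x z y : V} (p : G.graph.Walk x z)
    (hzy : G.graph.Adj z y) (hz : z ∈ H.ball x) (hy : y ∉ H.ball x) :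
    (H.radius x : ℝ≥0∞) + h.skeleton.dist (H.hub x) (H.hub y) ≤
      3 * α * (G.walkWeight p + G.weight s(z, y)) + H.radius y := by
  have hradius : (H.radius x : ℝ≥0∞) ≤ α * (G.walkWeight p + G.weight s(z, y)) := by
    refine (h.radius_le_of_notMem_ball x y hy).trans (mul_le_mul_right ?_ _)
    exact_mod_cast (G.dist_triangle x z y).trans
      (add_le_add (WGraph.dist_le_walkWeight p) (WGraph.dist_le_weight hzy))
  have hest : (H.est x z : ℝ≥0∞) ≤ α * G.walkWeight p :=
    (h.est_le x z hz).trans (mul_le_mul_right (by exact_mod_cast WGraph.dist_le_walkWeight p) _)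
  have hweight : (G.weight s(z, y) : ℝ≥0∞) ≤ α * G.weight s(z, y) := le_mul_of_one_le_left' hα
  have hdist : (h.skeleton.dist (H.hub x) (H.hub y) : ℝ≥0∞) ≤
      H.radius x + (H.est x z + (G.weight s(z, y) + H.radius y)) := by
    have := h.skeleton_dist_hub_le hz y
    rw [WGraph.hopLength_incident_of_adj hzy] at this
    exact_mod_cast this
  calc _ ≤ (H.radius x : ℝ≥0∞) + (H.radius x + (H.est x z + (G.weight s(z, y) + H.radius y))) := by
        gcongr
    _ ≤ α * (G.walkWeight p + G.weight s(z, y)) + (α * (G.walkWeight p + G.weight s(z, y)) +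
        (α * G.walkWeight p + (α * G.weight s(z, y) + H.radius y))) := by gcongr
    _ = _ := by ring

theorem radius_add_skeleton_dist_le (hα : 1 ≤ α) {x v : V} (p : G.graph.Walk x v) :
    (H.radius x : ℝ≥0∞) + h.skeleton.dist (H.hub x) (H.hub v) ≤
      3 * α * G.walkWeight p + (2 * α + 1) * H.radius v := by
  induction hlen : p.length using Nat.strong_induction_on generalizing x with
  | _ m ih =>
    by_cases hv : v ∈ H.ball x
    · exact h.radius_add_skeleton_dist_le_of_mem_ball p hv
    obtain ⟨z, y, hzy, p₁, p₂, hz, hy, hsum, hlt⟩ :=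
      WGraph.exists_crossing p (h.self_mem_ball x) hv
    have htriangle : (h.skeleton.dist (H.hub x) (H.hub v) : ℝ≥0∞) ≤
        h.skeleton.dist (H.hub x) (H.hub y) + h.skeleton.dist (H.hub y) (H.hub v) := by
      exact_mod_cast h.skeleton.dist_triangle _ (H.hub y) _
    calc _ ≤ (H.radius x : ℝ≥0∞) + (h.skeleton.dist (H.hub x) (H.hub y) +
          h.skeleton.dist (H.hub y) (H.hub v)) := by gcongr
      _ = (H.radius x + h.skeleton.dist (H.hub x) (H.hub y)) +
          h.skeleton.dist (H.hub y) (H.hub v) := by rw [add_assoc]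
      _ ≤ 3 * α * (G.walkWeight p₁ + G.weight s(z, y)) + H.radius y +
          h.skeleton.dist (H.hub y) (H.hub v) := by
        gcongr ?_ + _
        exact h.radius_add_skeleton_dist_le_of_adj hα p₁ hzy hz hy
      _ = 3 * α * (G.walkWeight p₁ + G.weight s(z, y)) +
          (H.radius y + h.skeleton.dist (H.hub y) (H.hub v)) := by rw [add_assoc]
      _ ≤ 3 * α * (G.walkWeight p₁ + G.weight s(z, y)) +
          (3 * α * G.walkWeight p₂ + (2 * α + 1) * H.radius v) := by
        gcongr _ + ?_
        exact ih p₂.length (hlen ▸ hlt) p₂ rfl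
      _ = _ := by rw [hsum]; push_cast; ring

end IsApprox

end HubSystem

/-- A finite estimate is rounded down to a natural number that is at most `K`, so that it fits in a
message; an infinite one is kept. -/
noncomputable def roundDown (K : ℕ) (x : ℝ≥0∞) : ℕ∞ := if x = ⊤ then ⊤ else min ⌊x⌋ₑ K

theorem capped_roundDown (K : ℕ) (x : ℝ≥0∞) : Capped K (roundDown K x) := by
  unfold roundDown
  split_ifs
  exacts [Or.inl rfl, Or.inr (min_le_right _ _)]

theorem roundDown_le (K : ℕ) (x : ℝ≥0∞) : (roundDown K x : ℝ≥0∞) ≤ x := by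
  unfold roundDown
  split_ifs with hx
  · simp [hx]
  · exact (ENat.toENNReal_le.2 (min_le_left _ _)).trans ENat.floor_le_self

theorem le_roundDown {K : ℕ} {d : ℕ∞} {x : ℝ≥0∞} (hd : Capped K d) (h : (d : ℝ≥0∞) ≤ x) :
    d ≤ roundDown K x := by
  unfold roundDown
  split_ifs with hx
  · exact le_top
  · refine le_min (ENat.le_floor.2 h) (hd.resolve_left ?_)
    rintro rfl
    exact hx (top_le_iff.1 h)

theorem IsApproxOn.roundDown {V : Type} {S : Finset V} {α : ℝ} {d : V → V → ℕ∞}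
    {f : V → V → ℝ≥0∞} {K : ℕ} (h : IsApproxOn S α d f) (hd : ∀ u v, Capped K (d u v)) :
    IsApproxOn S α d fun u v => roundDown K (f u v) := fun u hu v hv =>
  ⟨ENat.toENNReal_le.2 (le_roundDown (hd u v) (h u hu v hv).1),
    (roundDown_le K _).trans (h u hu v hv).2⟩

namespace HubSystem

variable {V : Type} (H : HubSystem V)

/-- The estimate of the distance from `v` to `u` obtained from estimates `D` between hubs: the
estimate that `u` has of it, if `v` is in the ball of `u`, or the route through the two hubs. -/
noncomputable def extension [DecidableEq V] (D : V → V → ℕ∞) (v u : V) : ℕ∞ :=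
  min (if v ∈ H.ball u then (H.est u v : ℕ∞) else ⊤)
    (H.radius v + D (H.hub u) (H.hub v) + H.radius u)

namespace IsApprox

variable {H} {G : WGraph V} {α : ℝ≥0∞} {S : Finset V} (h : H.IsApprox G α S)
  {D : V → V → ℕ∞}

include h

theorem dist_le_extension [DecidableEq V]
    (hD : ∀ s ∈ S, ∀ t ∈ S, h.skeleton.dist s t ≤ D s t) (v u : V) :
    G.dist v u ≤ H.extension D v u := by
  refine le_min ?_ ?_
  · split_ifs with hv
    · exact G.dist_comm v u ▸ h.dist_le_est u v hv
    · exact le_top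
  · calc G.dist v u ≤ G.dist v (H.hub v) + G.dist (H.hub v) (H.hub u) + G.dist (H.hub u) u :=
        (G.dist_triangle v _ u).trans (by gcongr; exact G.dist_triangle v _ _)
      _ ≤ _ := by
        gcongr
        · exact h.dist_hub_le v
        · rw [G.dist_comm]
          exact (h.dist_le_skeleton_dist _ _).trans (hD _ (h.hub_mem u) _ (h.hub_mem v))
        · exact G.dist_comm _ u ▸ h.dist_hub_le u

theorem radius_add_skeleton_dist_add_radius_le (hα : 1 ≤ α) {u v : V} (huv : G.dist u v ≠ ⊤)
    (hv : v ∉ H.ball u) :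
    (H.radius v : ℝ≥0∞) + h.skeleton.dist (H.hub u) (H.hub v) + H.radius u ≤
      7 * α ^ 2 * G.dist u v := by
  obtain ⟨p, hp⟩ := WGraph.exists_dist_eq_walkWeight huv
  have hradius : (H.radius u : ℝ≥0∞) ≤ α * G.walkWeight p := by
    have := h.radius_le_of_notMem_ball u v hv
    rwa [hp] at this
  have hskeleton := h.radius_add_skeleton_dist_le hα p.reverse
  rw [WGraph.walkWeight_reverse, h.skeleton.dist_comm] at hskeleton
  calc _ ≤ 3 * α * G.walkWeight p + (2 * α + 1) * H.radius u + H.radius u := by gcongr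
    _ ≤ 3 * α * G.walkWeight p + (2 * α + 1) * (α * G.walkWeight p) + α * G.walkWeight p := by
      gcongr
    _ = 2 * α ^ 2 * G.walkWeight p + 5 * (α * 1) * G.walkWeight p := by ring
    _ ≤ 2 * α ^ 2 * G.walkWeight p + 5 * (α * α) * G.walkWeight p := by gcongr
    _ = 7 * α ^ 2 * G.walkWeight p := by ring
    _ = 7 * α ^ 2 * G.dist u v := by rw [hp]; rfl

theorem extension_le [DecidableEq V] (hα : 1 ≤ α) {l : ℝ≥0∞} (hl : 1 ≤ l)
    (hD : ∀ s ∈ S, ∀ t ∈ S, (D s t : ℝ≥0∞) ≤ l * h.skeleton.dist s t) (v u : V) :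
    (H.extension D v u : ℝ≥0∞) ≤ 7 * l * α ^ 2 * G.dist v u := by
  have hα0 : α ≠ 0 := (zero_lt_one.trans_le hα).ne'
  have hl0 : l ≠ 0 := (zero_lt_one.trans_le hl).ne'
  rw [G.dist_comm]
  by_cases huv : G.dist u v = ⊤
  · rw [huv, ENat.toENNReal_top, ENNReal.mul_top (by simp [hα0, hl0])]
    exact le_top
  by_cases hv : v ∈ H.ball u
  · have hest : (H.extension D v u : ℝ≥0∞) ≤ H.est u v := by
      rw [extension, if_pos hv]
      exact_mod_cast min_le_left _ _
    calc _ ≤ α * G.dist u v := hest.trans (h.est_le u v hv)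
      _ = 1 * 1 * (1 * α) * G.dist u v := by simp only [one_mul]
      _ ≤ 7 * l * (α * α) * G.dist u v := by gcongr; norm_num
      _ = _ := by rw [sq]
  · have hhubs : (H.extension D v u : ℝ≥0∞) ≤
        H.radius v + D (H.hub u) (H.hub v) + H.radius u := by
      exact_mod_cast min_le_right _ _
    calc
      _ ≤ (1 * H.radius v + l * h.skeleton.dist (H.hub u) (H.hub v) + 1 * H.radius u : ℝ≥0∞) := by
          rw [one_mul, one_mul]
          refine hhubs.trans ?_
          gcongr
          exact hD _ (h.hub_mem u) _ (h.hub_mem v)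
      _ ≤ l * H.radius v + l * h.skeleton.dist (H.hub u) (H.hub v) + l * H.radius u := by gcongr
      _ = l * (H.radius v + h.skeleton.dist (H.hub u) (H.hub v) + H.radius u) := by ring
      _ ≤ l * (7 * α ^ 2 * G.dist u v) := by
        gcongr
        exact h.radius_add_skeleton_dist_add_radius_le hα huv hv
      _ = _ := by ring

end IsApprox

variable {H} in
theorem IsApprox.isApproxOn_extension [Fintype V] [DecidableEq V] {G : WGraph V}
    {S : Finset V} {a l : ℝ}
    (h : H.IsApprox G (ENNReal.ofReal a) S) (ha : 1 ≤ a) (hl : 1 ≤ l) {D : V → V → ℕ∞}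
    (hD : IsApproxOn S l h.skeleton.dist fun s t => D s t) :
    IsApproxOn Finset.univ (7 * l * a ^ 2) G.dist fun v u => H.extension D v u := by
  intro v _ u _
  constructor
  · exact ENat.toENNReal_le.2 (h.dist_le_extension
      (fun s hs t ht => ENat.toENNReal_le.1 (hD s hs t ht).1) v u)
  · have hfactor : ENNReal.ofReal (7 * l * a ^ 2) =
        7 * ENNReal.ofReal l * ENNReal.ofReal a ^ 2 := by
      rw [ENNReal.ofReal_mul (by positivity), ENNReal.ofReal_mul (by norm_num),
        ENNReal.ofReal_pow (by positivity), ENNReal.ofReal_ofNat]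
    rw [hfactor]
    exact h.extension_le (ENNReal.one_le_ofReal.2 ha) (ENNReal.one_le_ofReal.2 hl)
      (fun s hs t ht => (hD s hs t ht).2) v u

end HubSystem

namespace LocalInput

variable {n : ℕ} (M : ℕ) (I : LocalInput n) (S : Finset (Fin n)) (v : Fin n)

/-- The distance estimate for `z`, capped at `M`. -/
def estimate (z : Fin n) : ℕ := min ((I.est z).getD 0).toNat M

/-- Nodes are compared by their distance estimates, with ties broken by identifiers. -/
def key (z : Fin n) : ℕ ×ₗ Fin n := toLex (I.estimate M z, z)

open Classical in
/-- The node of `S` that comes first in the near set; `v` itself (a junk value) if the near set does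
not meet `S`. -/
noncomputable def hub : Fin n :=
  if h : (I.near ∩ S).Nonempty then (Finset.exists_min_image _ (I.key M) h).choose else v

/-- The distance estimate for the hub. -/
noncomputable def radius : ℕ := I.estimate M (I.hub M S v)

/-- The part of the near set that comes no later than the hub. -/
noncomputable def ball : Finset (Fin n) :=
  I.near.filter fun z => I.key M z ≤ I.key M (I.hub M S v)

theorem estimate_le (z : Fin n) : I.estimate M z ≤ M := min_le_right _ _

theorem radius_le : I.radius M S v ≤ M := I.estimate_le M _

theorem key_injective : Function.Injective (I.key M) :=
  fun _ _ h => congrArg (fun x => (ofLex x).2) h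

variable {M I S}

theorem estimate_le_estimate {y z : Fin n} (h : I.key M y ≤ I.key M z) :
    I.estimate M y ≤ I.estimate M z := Prod.Lex.monotone_fst _ _ h

theorem hub_mem_inter (h : (I.near ∩ S).Nonempty) : I.hub M S v ∈ I.near ∩ S := by
  rw [hub, dif_pos h]
  exact (Finset.exists_min_image _ (I.key M) h).choose_spec.1

theorem key_hub_le {s : Fin n} (hs : s ∈ I.near) (hs' : s ∈ S) :
    I.key M (I.hub M S v) ≤ I.key M s := by
  have h : (I.near ∩ S).Nonempty := ⟨s, Finset.mem_inter.2 ⟨hs, hs'⟩⟩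
  rw [hub, dif_pos h]
  exact (Finset.exists_min_image _ (I.key M) h).choose_spec.2 s (Finset.mem_inter.2 ⟨hs, hs'⟩)

theorem radius_le_estimate_of_notMem_ball {z : Fin n} (hz : z ∈ I.near) (h : z ∉ I.ball M S v) :
    I.radius M S v ≤ I.estimate M z :=
  estimate_le_estimate (le_of_not_ge fun hle => h (Finset.mem_filter.2 ⟨hz, hle⟩))

variable (M S) in
/-- The hub system for the hubs in `S` determined by the local inputs. -/
noncomputable def hubSystem (I : Fin n → LocalInput n) : HubSystem (Fin n) where
  hub v := (I v).hub M S v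
  radius v := (I v).radius M S v
  ball v := (I v).ball M S v
  est v := (I v).estimate M

end LocalInput

namespace IsLocalApprox

theorem self_mem {V : Type} {G : WGraph V} {a : ℝ} {δ : V → V → ℤ} {N : V → Finset V}
    (h : IsLocalApprox G a δ N) {u : V} (hu : (N u).Nonempty) : u ∈ N u := by
  by_contra hmem
  obtain ⟨z, hz⟩ := hu
  have hfar := h.far u z hz u hmem
  rw [G.dist_self, ENat.toENNReal_zero, mul_zero] at hfar
  have hdist : G.dist u z = 0 := by simpa using (h.lower u z hz).trans hfar
  exact hmem (WGraph.eq_of_dist_eq_zero hdist ▸ hz)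

variable {n M : ℕ} {G : WGraph (Fin n)} {a : ℝ} {δ : Fin n → Fin n → ℤ}
  {N : Fin n → Finset (Fin n)} (h : IsLocalApprox G a δ N)

include h

theorem dist_le_estimate (hM : ∀ u v, Capped M (G.dist u v)) {x z : Fin n} (hz : z ∈ N x) :
    G.dist x z ≤ (localInput G δ N x).estimate M z := by
  have hlower : G.dist x z ≤ (δ x z).toNat := ENat.toENNReal_le.1 (by exact_mod_cast h.lower x z hz)
  have hcap : G.dist x z ≤ M :=
    (hM x z).resolve_left (hlower.trans_lt (ENat.natCast_lt_top _)).ne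
  have hestimate : (localInput G δ N x).estimate M z = min (δ x z).toNat M := by
    simp [LocalInput.estimate, localInput, hz]
  rcases min_choice (δ x z).toNat M with hmin | hmin <;> rw [hestimate, hmin]
  exacts [hlower, hcap]

theorem estimate_le {x z : Fin n} (hz : z ∈ N x) :
    ((localInput G δ N x).estimate M z : ℝ≥0∞) ≤ ENNReal.ofReal a * G.dist x z := by
  refine le_trans ?_ (h.upper x z hz)
  simp [LocalInput.estimate, localInput, hz]

theorem estimate_le_of_notMem {x z t : Fin n} (hz : z ∈ N x) (ht : t ∉ N x) :
    ((localInput G δ N x).estimate M z : ℝ≥0∞) ≤ ENNReal.ofReal a * G.dist x t := by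
  refine le_trans ?_ (h.far x z hz t ht)
  simp [LocalInput.estimate, localInput, hz]

theorem isApprox_hubSystem (hM : ∀ u v, Capped M (G.dist u v)) {S : Finset (Fin n)}
    (hS : ∀ x, (N x ∩ S).Nonempty) :
    (LocalInput.hubSystem M S (localInput G δ N)).IsApprox G (ENNReal.ofReal a) S := by
  set H := LocalInput.hubSystem M S (localInput G δ N)
  have hub_mem (x) : H.hub x ∈ N x ∩ S := LocalInput.hub_mem_inter x (hS x)
  have hub_mem_near (x) : H.hub x ∈ N x := (Finset.mem_inter.1 (hub_mem x)).1
  have ball_subset (x) : H.ball x ⊆ N x := Finset.filter_subset _ _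
  have dist_hub_le (x) : G.dist x (H.hub x) ≤ H.radius x := h.dist_le_estimate hM (hub_mem_near x)
  have radius_le_of_estimate_le {x y : Fin n} (hy : y ∈ N x → H.radius x ≤ H.est x y) :
      (H.radius x : ℝ≥0∞) ≤ ENNReal.ofReal a * G.dist x y := by
    by_cases hmem : y ∈ N x
    · exact (Nat.cast_le.2 (hy hmem)).trans (h.estimate_le hmem)
    · exact h.estimate_le_of_notMem (hub_mem_near x) hmem
  have radius_le_of_notMem_ball (x) (y) (hy : y ∉ H.ball x) :
      (H.radius x : ℝ≥0∞) ≤ ENNReal.ofReal a * G.dist x y :=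
    radius_le_of_estimate_le fun hmem => LocalInput.radius_le_estimate_of_notMem_ball x hmem hy
  have self_mem_ball (x) : x ∈ H.ball x := by
    by_contra hx
    have hradius := radius_le_of_notMem_ball x x hx
    rw [G.dist_self, ENat.toENNReal_zero, mul_zero] at hradius
    have hradius0 : H.radius x = 0 := by exact_mod_cast nonpos_iff_eq_zero.1 hradius
    have hdist : G.dist x (H.hub x) = 0 :=
      nonpos_iff_eq_zero.1 ((dist_hub_le x).trans_eq (congrArg Nat.cast hradius0))
    exact hx (Finset.mem_filter.2 ⟨h.self_mem ⟨_, hub_mem_near x⟩,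
      le_of_eq (congrArg _ (WGraph.eq_of_dist_eq_zero hdist))⟩)
  exact
    { hub_mem := fun x => (Finset.mem_inter.1 (hub_mem x)).2
      self_mem_ball := self_mem_ball
      dist_hub_le := dist_hub_le
      dist_le_est := fun x z hz => h.dist_le_estimate hM (ball_subset x hz)
      est_le := fun x z hz => h.estimate_le (ball_subset x hz)
      radius_le_of_notMem_ball := radius_le_of_notMem_ball
      radius_le_of_mem := fun x s hs => radius_le_of_estimate_le fun hmem =>
        LocalInput.estimate_le_estimate (LocalInput.key_hub_le x hmem hs) }

end IsLocalApprox

/-! ### Programs and message encodings -/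

namespace CongestedClique

/-- The behaviour of one node: either it has an output, or it sends messages and continues
depending on the messages it receives. -/
inductive Program (n β : ℕ) (Out : Type) : Type
  | ret (o : Out) : Program n β Out
  | round (m : Fin n → Msg n β) (k : (Fin n → Msg n β) → Program n β Out) : Program n β Out

namespace Program

variable {n β : ℕ} {In Out : Type}

/-- The messages sent next; a node that has its output sends arbitrary messages. -/
def msg : Program n β Out → Fin n → Msg n β
  | ret _ => fun _ _ => false
  | round m _ => m

/-- The behaviour after receiving messages. -/
def step : Program n β Out → (Fin n → Msg n β) → Program n β Out
  | ret o => fun _ => ret o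
  | round _ k => k

/-- The output, or a junk value if there is none yet. -/
def out [Inhabited Out] : Program n β Out → Out
  | ret o => o
  | round _ _ => default

/-- One synchronous round of a system of programs. -/
def next (P : Fin n → Program n β Out) : Fin n → Program n β Out :=
  fun v => (P v).step fun u => (P u).msg v

/-- The algorithm in which node `v` with input `x` runs the program `P v x`. -/
def toAlgorithm [Inhabited Out] (P : Fin n → In → Program n β Out) : Algorithm n β In Out where
  State := Program n β Out
  init := P
  send _ s v := s.msg v
  step _ s m := s.step m
  output _ s := s.out

theorem stateAfter_toAlgorithm [Inhabited Out] (P : Fin n → In → Program n β Out) (x : Fin n → In)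
    (R : ℕ) : (toAlgorithm P).stateAfter x R = next^[R] fun v => P v (x v) := by
  induction R with
  | zero => rfl
  | succ R ih =>
    rw [Function.iterate_succ_apply', ← ih]
    rfl

theorem run_toAlgorithm [Inhabited Out] {P : Fin n → In → Program n β Out} {x : Fin n → In} {R : ℕ}
    {y : Fin n → Out} (h : (next^[R] fun v => P v (x v)) = fun v => ret (y v)) :
    (toAlgorithm P).run R x = y := by
  funext v
  rw [← stateAfter_toAlgorithm] at h
  exact congrArg out (congrFun h v)

end Program

/-- The set `A` has at most `2 ^ (b * (⌊log₂ n⌋ + 1))` elements, so that an element of `A` can be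
sent in a message of `b * (⌊log₂ n⌋ + 1)` bits. -/
def Fits (n b : ℕ) {T : Type} (A : Set T) : Prop :=
  A.encard ≤ ((2 ^ (Nat.log 2 n + 1)) ^ b : ℕ)

section Fits

variable {n b b' : ℕ} {T T' : Type} {A : Set T} {A' : Set T'}

theorem two_le_two_pow_log_succ (n : ℕ) : 2 ≤ 2 ^ (Nat.log 2 n + 1) := by
  rw [pow_succ]
  exact Nat.le_mul_of_pos_left 2 (by positivity)

theorem lt_two_pow_log_succ (n : ℕ) : n < 2 ^ (Nat.log 2 n + 1) :=
  Nat.lt_pow_succ_log_self (by norm_num) n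

theorem Fits.mono (h : Fits n b A) (hb : b ≤ b') : Fits n b' A :=
  h.trans (by exact_mod_cast Nat.pow_le_pow_right (by positivity) hb)

theorem Fits.prod (h : Fits n b A) (h' : Fits n b' A') : Fits n (b + b') (A ×ˢ A') := by
  rw [Fits, Set.encard_prod, pow_add, Nat.cast_mul]
  exact mul_le_mul' h h'

theorem Fits.image (h : Fits n b A) (f : T → T') : Fits n b (f '' A) :=
  (Set.encard_image_le f A).trans h

theorem Fits.insert (h : Fits n b A) (x : T) : Fits n (b + 1) (insert x A) := by
  have hpow : (2 ^ (Nat.log 2 n + 1)) ^ b + 1 ≤ (2 ^ (Nat.log 2 n + 1)) ^ (b + 1) := by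
    have := Nat.mul_le_mul_left ((2 ^ (Nat.log 2 n + 1)) ^ b) (two_le_two_pow_log_succ n)
    have : 0 < (2 ^ (Nat.log 2 n + 1)) ^ b := by positivity
    rw [pow_succ _ b]
    omega
  calc _ ≤ A.encard + 1 := Set.encard_insert_le _ _
    _ ≤ (((2 ^ (Nat.log 2 n + 1)) ^ b : ℕ) : ℕ∞) + 1 := add_le_add_left h 1
    _ ≤ _ := by exact_mod_cast hpow

theorem Fits.pi (h : Fits n b A) (m : ℕ) : Fits n (b * m) (Set.univ.pi fun _ : Fin m => A) := by
  rw [Fits, Set.encard_pi_eq_prod_encard, Finset.prod_const, Finset.card_univ, Fintype.card_fin,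
    pow_mul]
  push_cast
  exact pow_le_pow_left' (by exact_mod_cast h) m

theorem fits_univ [Fintype T] (h : Fintype.card T ≤ (2 ^ (Nat.log 2 n + 1)) ^ b) :
    Fits n b (Set.univ : Set T) := by
  rw [Fits, Set.encard_univ, ENat.card_eq_coe_fintype_card]
  exact_mod_cast h

theorem fits_bool (n : ℕ) : Fits n 1 (Set.univ : Set Bool) :=
  fits_univ (by simpa using two_le_two_pow_log_succ n)

theorem fits_fin (n : ℕ) : Fits n 1 (Set.univ : Set (Fin n)) :=
  fits_univ (by simpa using (lt_two_pow_log_succ n).le)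

theorem fits_Iic {m : ℕ} (h : m < (2 ^ (Nat.log 2 n + 1)) ^ b) : Fits n b (Set.Iic m) := by
  rw [Fits, ← Finset.coe_Iic, Set.encard_coe_eq_coe_finsetCard, Nat.card_Iic]
  exact_mod_cast h

theorem fits_Iic_mul_pow {m K : ℕ} (hK : K ≤ 4 * n ^ m) : Fits n (m + 3) (Set.Iic K) := by
  refine fits_Iic (hK.trans_lt ?_)
  have hconst : 2 ^ 3 ≤ (2 ^ (Nat.log 2 n + 1)) ^ 3 :=
    Nat.pow_le_pow_left (two_le_two_pow_log_succ n) 3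
  have hpow := Nat.pow_le_pow_left (lt_two_pow_log_succ n).le m
  calc 4 * n ^ m ≤ 4 * (2 ^ (Nat.log 2 n + 1)) ^ m := Nat.mul_le_mul_left 4 hpow
    _ < 2 ^ 3 * (2 ^ (Nat.log 2 n + 1)) ^ m := by gcongr; norm_num
    _ ≤ (2 ^ (Nat.log 2 n + 1)) ^ 3 * (2 ^ (Nat.log 2 n + 1)) ^ m := Nat.mul_le_mul_right _ hconst
    _ = (2 ^ (Nat.log 2 n + 1)) ^ (m + 3) := by rw [pow_add _ m 3, mul_comm]

theorem fits_capped {m K : ℕ} (hK : K ≤ 4 * n ^ m) : Fits n (m + 4) {x | Capped K x} := by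
  refine (Set.encard_le_encard ?_).trans (((fits_Iic_mul_pow hK).image ((↑) : ℕ → ℕ∞)).insert ⊤)
  rintro x (rfl | hx)
  · exact Set.mem_insert _ _
  · obtain ⟨w, rfl⟩ := ENat.ne_top_iff_exists.1 (hx.trans_lt (ENat.natCast_lt_top K)).ne
    exact Set.mem_insert_of_mem _ ⟨w, by exact_mod_cast hx, rfl⟩

end Fits

section Encode

variable {n β : ℕ} {T : Type}

open Classical in
/-- An encoding by messages that is injective on `A` if `A` fits into a message. -/
noncomputable def encode (n β : ℕ) (A : Set T) (x : T) : Msg n β :=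
  if h : ∃ f : T → Msg n β, A.InjOn f then h.choose x else fun _ => false

open Classical in
/-- The element of `A` with a given encoding, or `x₀` if there is none. -/
noncomputable def decode (A : Set T) (x₀ : T) (m : Msg n β) : T :=
  if h : ∃ x ∈ A, encode n β A x = m then h.choose else x₀

theorem Fits.injOn_encode {A : Set T} (h : Fits n β A) : A.InjOn (encode n β A) := by
  have hcard : A.encard ≤ (Set.univ : Set (Msg n β)).encard := by
    rw [Set.encard_univ, ENat.card_eq_coe_fintype_card, Fintype.card_fun, Fintype.card_bool,
      Fintype.card_fin, mul_comm β, pow_mul]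
    exact h
  obtain ⟨f, -, hf⟩ := (Set.finite_of_encard_le_coe h).exists_injOn_of_encard_le hcard
  have hexists : ∃ f : T → Msg n β, A.InjOn f := ⟨f, hf⟩
  have hencode : encode n β A = hexists.choose := funext fun x => dif_pos hexists
  exact hencode ▸ hexists.choose_spec

theorem Fits.decode_encode {A : Set T} (h : Fits n β A) (x₀ : T) {x : T} (hx : x ∈ A) :
    decode A x₀ (encode n β A x) = x := by
  have hexists : ∃ y ∈ A, encode n β A y = encode n β A x := ⟨x, hx, rfl⟩
  rw [decode, dif_pos hexists]
  exact h.injOn_encode hexists.choose_spec.1 hx hexists.choose_spec.2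

end Encode

namespace Program

variable {n β : ℕ} {Out T : Type} {A : Set T}

/-- Send the element `m u` of `A` to every node `u` and continue with the elements received. -/
noncomputable def exchange (A : Set T) (m : Fin n → T) (k : (Fin n → T) → Program n β Out) :
    Program n β Out :=
  round (fun u => encode n β A (m u)) fun ms => k fun u => decode A (m u) (ms u)

theorem next_iterate_exchange (hA : Fits n β A) {m : Fin n → Fin n → T} (hm : ∀ u v, m u v ∈ A)
    (k : Fin n → (Fin n → T) → Program n β Out) (R : ℕ) :
    next^[R + 1] (fun v => exchange A (m v) (k v)) = next^[R] fun v => k v fun u => m u v := by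
  rw [Function.iterate_succ_apply]
  congr 1
  funext v
  simp only [next, exchange, step, msg, hA.decode_encode _ (hm _ _)]

end Program

end CongestedClique

/-! ### Building the skeleton graph in constantly many rounds -/

namespace CongestedClique

section Routing

variable {n : ℕ} {α : Type} (κ : Fin n → ℕ)

open Classical in
/-- When every node `y` has `κ y` items, numbered consecutively throughout the network, this is the
item that `x` hands to the helper `q`: the one whose number is congruent to `q` modulo `n`. -/
noncomputable def handout (items : List α) (x q : Fin n) : Option α :=
  if h : ∃ i : Fin (κ x), (finSigmaFinEquiv ⟨x, i⟩ : ℕ) % n = q then items[(h.choose : ℕ)]?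
  else none

/-- The item with number `e` together with its owner, at a helper that was handed this item and
received `got x` from each node `x`. -/
def itemAt (got : Fin n → Option α) (e : ℕ) : Option (Fin n × α) :=
  if h : e < ∑ x, κ x then
    (got (finSigmaFinEquiv.symm ⟨e, h⟩).1).map ((finSigmaFinEquiv.symm ⟨e, h⟩).1, ·)
  else none

variable {κ}

theorem mem_of_handout_eq_some {items : List α} {x q : Fin n} {a : α}
    (h : handout κ items x q = some a) : a ∈ items := by
  rw [handout] at h
  split_ifs at h
  exact List.mem_of_getElem? h

theorem handout_eq_getElem? (items : List α) {x q : Fin n} (hκ : κ x ≤ n) (i : Fin (κ x))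
    (hq : (finSigmaFinEquiv ⟨x, i⟩ : ℕ) % n = q) : handout κ items x q = items[(i : ℕ)]? := by
  have h : ∃ i : Fin (κ x), (finSigmaFinEquiv ⟨x, i⟩ : ℕ) % n = q := ⟨i, hq⟩
  have hmod : h.choose ≡ i [MOD n] := by
    have hpos := h.choose_spec.trans hq.symm
    rw [finSigmaFinEquiv_apply, finSigmaFinEquiv_apply] at hpos
    exact Nat.ModEq.add_left_cancel' _ hpos
  rw [handout, dif_pos h,
    hmod.eq_of_lt_of_lt (h.choose.2.trans_le hκ) (i.2.trans_le hκ)]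

theorem eq_some_of_itemAt_eq_some {got : Fin n → Option α} {e : ℕ} {x : Fin n} {a : α}
    (h : itemAt κ got e = some (x, a)) : got x = some a := by
  rw [itemAt] at h
  split_ifs at h
  obtain ⟨b, hb, heq⟩ := Option.map_eq_some_iff.1 h
  obtain ⟨rfl, rfl⟩ := Prod.mk.inj heq
  exact hb

theorem itemAt_finSigmaFinEquiv (got : Fin n → Option α) (x : Fin n) (i : Fin (κ x)) :
    itemAt κ got (finSigmaFinEquiv ⟨x, i⟩) = (got x).map (x, ·) := by
  rw [itemAt, dif_pos (finSigmaFinEquiv _).2]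
  simp only [Fin.eta, Equiv.symm_apply_apply]

/-- The block of item numbers that worker `w` is responsible for when there are `m` columns. -/
def block (m : ℕ) (w : Fin n) : ℕ := w / m

/-- The element of `S` that worker `w` is responsible for. -/
noncomputable def column (S : Finset (Fin n)) (w : Fin n) : Option (Fin n) :=
  S.toList[w % S.card]?

theorem exists_block_eq_column_eq {S : Finset (Fin n)} {s : Fin n} (hs : s ∈ S) {j : ℕ}
    (hj : j < n / S.card) : ∃ w : Fin n, block S.card w = j ∧ column S w = some s := by
  obtain ⟨i, hi, rfl⟩ := List.mem_iff_getElem.1 (Finset.mem_toList.2 hs)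
  rw [Finset.length_toList] at hi
  have hlt : S.card * j + i < n :=
    calc S.card * j + i < S.card * (j + 1) := by rw [mul_add_one]; omega
      _ ≤ S.card * (n / S.card) := Nat.mul_le_mul_left _ hj
      _ ≤ n := Nat.mul_div_le n _
  refine ⟨⟨S.card * j + i, hlt⟩, ?_, ?_⟩
  · rw [block, Nat.mul_add_div (by omega), Nat.div_eq_of_lt hi, add_zero]
  · rw [column, Nat.mul_add_mod, Nat.mod_eq_of_lt hi, List.getElem?_eq_getElem]

/-- The items that helper `q` passes to worker `w`: the items of `q` in the `L` rows of `n`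
consecutive numbers that make up the block of `w`. -/
noncomputable def shipment (κ : Fin n → ℕ) (L : ℕ) (S : Finset (Fin n)) (got : Fin n → Option α)
    (q w : Fin n) : Fin L → Option (Fin n × α) :=
  fun t => itemAt κ got ((block S.card w * L + t) * n + q)

theorem exists_shipment_eq_some {L : ℕ} {S : Finset (Fin n)} {s : Fin n} (hs : s ∈ S)
    (hκ : ∀ x, κ x ≤ n) (hsum : ∑ x, κ x ≤ n / S.card * L * n) {items : Fin n → List α}
    (hitems : ∀ x, (items x).length = κ x) {x : Fin n} {a : α} (ha : a ∈ items x) :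
    ∃ (w q : Fin n) (t : Fin L), column S w = some s ∧
      shipment κ L S (fun x => handout κ (items x) x q) q w t = some (x, a) := by
  obtain ⟨i, hi, rfl⟩ := List.mem_iff_getElem.1 ha
  let j : Fin (κ x) := ⟨i, hitems x ▸ hi⟩
  set e := (finSigmaFinEquiv ⟨x, j⟩ : ℕ) with he
  have hrow : e / n < n / S.card * L :=
    Nat.div_lt_of_lt_mul ((Fin.is_lt _).trans_le (hsum.trans_eq (mul_comm _ _)))
  have hL : 0 < L := Nat.pos_of_mul_pos_left (Nat.zero_lt_of_lt hrow)
  have hblock : e / n / L < n / S.card := Nat.div_lt_of_lt_mul (hrow.trans_eq (mul_comm _ _))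
  obtain ⟨w, hw, hws⟩ := exists_block_eq_column_eq hs hblock
  refine ⟨w, ⟨e % n, Nat.mod_lt _ x.pos⟩, ⟨e / n % L, Nat.mod_lt _ hL⟩, hws, ?_⟩
  have hnumber : (block S.card w * L + e / n % L) * n + e % n = e := by
    rw [hw, Nat.div_add_mod', Nat.div_add_mod']
  rw [shipment, hnumber, he, itemAt_finSigmaFinEquiv, handout_eq_getElem? _ (hκ x) _ rfl,
    List.getElem?_eq_getElem hi, Option.map_some]

theorem mem_of_shipment_eq_some {L : ℕ} {S : Finset (Fin n)} {items : Fin n → List α}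
    {q w x : Fin n} {t : Fin L} {a : α}
    (h : shipment κ L S (fun x => handout κ (items x) x q) q w t = some (x, a)) : a ∈ items x :=
  mem_of_handout_eq_some (eq_some_of_itemAt_eq_some
    (got := fun x => handout κ (items x) x q) h)

end Routing

end CongestedClique

namespace CongestedClique

open Program

section Build

variable {n : ℕ}

/-- The items of a node: the nodes of its ball with their estimates. -/
noncomputable def itemList (ball : Finset (Fin n)) (est : Fin n → ℕ) : List (Fin n × ℕ) :=
  ball.toList.map fun z => (z, est z)

/-- The length of the shortest connection from the hub `s` that a worker finds among the items
`(z, c)` of `x` sent to it as `(x, z, c)`, if `g z` is the length of the rest of the connection. -/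
noncomputable def partialCost {L : ℕ} (hub : Fin n → Fin n) (radius : Fin n → ℕ)
    (items : Fin n → Fin L → Option (Fin n × Fin n × ℕ)) (g : Fin n → ℕ∞) (s : Fin n) : ℕ∞ :=
  ⨅ (q) (t) (x) (z) (c) (_ : items q t = some (x, z, c)) (_ : hub x = s),
    (radius x : ℕ∞) + (c + g z)

/-- The minimum over the workers for the hub `t`. -/
noncomputable def collect (S : Finset (Fin n)) (f : Fin n → ℕ∞) (t : Fin n) : ℕ∞ :=
  ⨅ (w) (_ : column S w = some t), f w

/-- The skeleton edge between `v` and `u`, given its length. -/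
noncomputable def skeletonEdge (S : Finset (Fin n)) (v u : Fin n) (c : ℕ∞) : Option ℕ :=
  if v ≠ u ∧ v ∈ S ∧ u ∈ S ∧ c ≠ ⊤ then some c.toNat else none

/-- The options whose value, if any, lies in `A`. -/
def optionSet {T : Type} (A : Set T) : Set (Option T) := {o | ∀ x ∈ o, x ∈ A}

/-- The alphabet of the messages `(hub, radius, size of the ball)`. -/
def infoSet (n M : ℕ) : Set (Fin n × ℕ × ℕ) := Set.univ ×ˢ Set.Iic M ×ˢ Set.Iic n

/-- The alphabet of the items. -/
def itemSet (n M : ℕ) : Set (Fin n × ℕ) := Set.univ ×ˢ Set.Iic M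

/-- The alphabet of the messages sent to a worker: a shipment of items, and the length of the
connection from the sender to the hub of the worker. -/
def shipmentSet (n L M : ℕ) : Set ((Fin L → Option (Fin n × Fin n × ℕ)) × ℕ∞) :=
  (Set.univ.pi fun _ => optionSet (Set.univ ×ˢ itemSet n M)) ×ˢ {x | Capped (4 * M) x}

/-- The construction of the skeleton graph over `S` from a hub system and the local inputs, as a
program for node `v`. The workers of a block of item numbers receive all items with these numbers
and compute the costs that are due to them, each worker for a single target hub. -/
noncomputable def build (β M : ℕ) (S : Finset (Fin n)) (v hub : Fin n) (radius : ℕ)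
    (ball : Finset (Fin n)) (est : Fin n → ℕ) (edges : Fin n → Option ℕ) :
    Program n β (LocalSkeleton n) :=
  exchange (infoSet n M) (fun _ => (hub, radius, ball.card)) fun info =>
  exchange (optionSet (itemSet n M))
    (fun q => handout (fun x => (info x).2.2) (itemList ball est) v q) fun got =>
  exchange (shipmentSet n 128 M) (fun w => (shipment (fun x => (info x).2.2) 128 S got v w,
    (column S w).elim ⊤ fun t => reach (fun y => (info y).1) (fun y => (info y).2.1) edges v t))
    fun ship =>
  exchange {x | Capped (4 * M) x} (fun s => partialCost (fun y => (info y).1)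
    (fun y => (info y).2.1) (fun q => (ship q).1) (fun z => (ship z).2) s) fun part =>
  exchange {x | Capped (4 * M) x} (fun t => collect S part t) fun back =>
  ret ⟨decide (v ∈ S), fun u => skeletonEdge S v u (min (collect S part u) (back u))⟩

theorem Fits.optionSet {b : ℕ} {T : Type} {A : Set T} (h : Fits n b A) :
    Fits n (b + 1) (optionSet A) := by
  refine (Set.encard_le_encard ?_).trans ((h.image some).insert none)
  rintro (_ | x) hx
  exacts [Set.mem_insert _ _, Set.mem_insert_of_mem _ ⟨x, hx x rfl, rfl⟩]

section Alphabets

variable {M m : ℕ} (hM : M ≤ n ^ m)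

include hM

theorem fits_itemSet : Fits n (m + 4) (itemSet n M) :=
  ((fits_fin n).prod (fits_Iic_mul_pow (m := m) (hM.trans (by omega)))).mono (by omega)

theorem fits_infoSet : Fits n (m + 5) (infoSet n M) :=
  ((fits_fin n).prod ((fits_Iic_mul_pow (m := m) (hM.trans (by omega))).prod
    (fits_Iic (b := 1) (by simpa using lt_two_pow_log_succ n)))).mono (by omega)

theorem fits_shipmentSet (L : ℕ) : Fits n ((L + 1) * (m + 6)) (shipmentSet n L M) :=
  ((((fits_fin n).prod (fits_itemSet hM)).optionSet.pi L).prod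
    (fits_capped (Nat.mul_le_mul_left 4 hM))).mono (by ring_nf; omega)

end Alphabets

end Build

end CongestedClique

namespace HubSystem

open CongestedClique Program

variable {n : ℕ} (H : HubSystem (Fin n)) (edges : Fin n → Fin n → Option ℕ) (L : ℕ)
  (S : Finset (Fin n))

/-- The shipment that worker `w` receives from helper `q`. -/
noncomputable def parcel (w q : Fin n) : Fin L → Option (Fin n × Fin n × ℕ) :=
  shipment (fun y => (H.ball y).card) L S
    (fun x => handout (fun y => (H.ball y).card) (itemList (H.ball x) (H.est x)) x q) q w

/-- The length of the connection from `z` to the hub of worker `w`. -/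
noncomputable def columnReach (w z : Fin n) : ℕ∞ :=
  (column S w).elim ⊤ fun t => reach H.hub H.radius (edges z) z t

/-- The length of the shortest connection from `s` to the hub of worker `w` through the items
received by `w`. -/
noncomputable def workerCost (w s : Fin n) : ℕ∞ :=
  partialCost H.hub H.radius (H.parcel L S w) (H.columnReach edges S w) s

variable {H edges L S}

theorem of_parcel_eq_some {w q x z : Fin n} {t : Fin L} {c : ℕ}
    (h : H.parcel L S w q t = some (x, z, c)) : z ∈ H.ball x ∧ c = H.est x z := by
  have hmem := mem_of_shipment_eq_some (items := fun x => itemList (H.ball x) (H.est x)) h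
  obtain ⟨y, hy, heq⟩ := List.mem_map.1 hmem
  obtain ⟨rfl, rfl⟩ := Prod.mk.inj heq
  exact ⟨Finset.mem_toList.1 hy, rfl⟩

theorem exists_parcel_eq_some {s x z : Fin n} (hs : s ∈ S) (hz : z ∈ H.ball x)
    (hsum : ∑ x, (H.ball x).card ≤ n / S.card * L * n) :
    ∃ (w q : Fin n) (t : Fin L), column S w = some s ∧
      H.parcel L S w q t = some (x, z, H.est x z) :=
  exists_shipment_eq_some (items := fun x => itemList (H.ball x) (H.est x)) hs
    (fun x => card_finset_fin_le (H.ball x)) hsum (fun x => by simp [itemList])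
    (List.mem_map_of_mem (Finset.mem_toList.2 hz))

theorem collect_workerCost (hsum : ∑ x, (H.ball x).card ≤ n / S.card * L * n) (s : Fin n)
    {t : Fin n} (ht : t ∈ S) :
    collect S (fun w => H.workerCost edges L S w s) t = H.cost edges s t := by
  apply le_antisymm
  · refine le_iInf fun x => le_iInf fun hx => le_iInf fun z => le_iInf fun hz => ?_
    obtain ⟨w, q, i, hw, hi⟩ := exists_parcel_eq_some ht hz hsum
    calc collect S (fun w => H.workerCost edges L S w s) t ≤ H.workerCost edges L S w s :=
          iInf₂_le w hw
      _ ≤ H.radius x + (H.est x z + H.columnReach edges S w z) :=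
          iInf₂_le_of_le q i <| iInf₂_le_of_le x z <| iInf_le_of_le _ <| iInf₂_le hi hx
      _ = _ := by rw [columnReach, hw, Option.elim_some]
  · refine le_iInf fun w => le_iInf fun hw => le_iInf fun q => le_iInf fun i => le_iInf fun x =>
      le_iInf fun z => le_iInf fun c => le_iInf fun hi => le_iInf fun hx => ?_
    obtain ⟨hz, rfl⟩ := of_parcel_eq_some hi
    rw [columnReach, hw, Option.elim_some]
    exact iInf₂_le_of_le x hx (iInf₂_le z hz)

section Capped

variable {M : ℕ} (hradius : ∀ x, H.radius x ≤ M) (hest : ∀ x z, H.est x z ≤ M)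
  (hedges : ∀ z y w, edges z y = some w → w ≤ M)

include hradius hedges in
theorem capped_columnReach (w z : Fin n) : Capped (M + M) (H.columnReach edges S w z) := by
  rw [columnReach]
  rcases column S w with _ | t
  exacts [Or.inl rfl, capped_reach hradius (hedges z) z t]

include hest in
theorem handout_mem_optionSet (κ : Fin n → ℕ) (x q : Fin n) :
    handout κ (itemList (H.ball x) (H.est x)) x q ∈ optionSet (itemSet n M) := by
  intro a ha
  obtain ⟨z, -, rfl⟩ := List.mem_map.1 (mem_of_handout_eq_some ha)
  exact ⟨trivial, hest x z⟩

include hradius hest hedges in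
theorem parcel_columnReach_mem_shipmentSet (w q : Fin n) :
    (H.parcel L S w q, H.columnReach edges S w q) ∈ shipmentSet n L M := by
  refine ⟨fun t _ => ?_, (capped_columnReach hradius hedges w q).mono (by omega)⟩
  rintro ⟨x, z, c⟩ hc
  obtain ⟨-, rfl⟩ := of_parcel_eq_some hc
  exact ⟨trivial, trivial, hest x z⟩

include hradius hest hedges in
theorem capped_workerCost (w s : Fin n) : Capped (4 * M) (H.workerCost edges L S w s) := by
  refine .iInf fun q => .iInf fun t => .iInf fun x => .iInf fun z => .iInf fun c =>
    .iInf fun hc => .iInf fun _ => ?_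
  obtain ⟨-, rfl⟩ := of_parcel_eq_some hc
  exact (Capped.add (.coe (hradius x))
    (.add (.coe (hest x z)) (capped_columnReach hradius hedges w z))).mono (by omega)

include hradius hest hedges in
theorem next_iterate_build {m β : ℕ} (hM : M ≤ n ^ m) (hβ : 129 * (m + 6) ≤ β)
    (hsum : ∑ x, (H.ball x).card ≤ n / S.card * 128 * n) :
    next^[5] (fun v => build β M S v (H.hub v) (H.radius v) (H.ball v) (H.est v) (edges v)) =
      fun v => ret ⟨decide (v ∈ S), fun u => skeletonEdge S v u (H.edgeLength edges v u)⟩ := by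
  have fits_cost : Fits n β {x | Capped (4 * M) x} :=
    (fits_capped (Nat.mul_le_mul_left 4 hM)).mono (by omega)
  have info_mem (v _u : Fin n) : (H.hub v, H.radius v, (H.ball v).card) ∈ infoSet n M :=
    ⟨trivial, hradius v, card_finset_fin_le _⟩
  have capped_cost (v u : Fin n) : collect S (fun w => H.workerCost edges 128 S w v) u ∈
      {x | Capped (4 * M) x} :=
    .iInf fun w => .iInf fun _ => capped_workerCost hradius hest hedges w v
  refine (next_iterate_exchange ((fits_infoSet hM).mono (by omega)) info_mem _ 4).trans <|
    (next_iterate_exchange ((fits_itemSet hM).optionSet.mono (by omega))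
      (handout_mem_optionSet hest fun y => (H.ball y).card) _ 3).trans <|
    (next_iterate_exchange ((fits_shipmentSet hM 128).mono hβ)
      (fun q w => parcel_columnReach_mem_shipmentSet hradius hest hedges w q) _ 2).trans <|
    (next_iterate_exchange fits_cost (capped_workerCost hradius hest hedges) _ 1).trans <|
    (next_iterate_exchange fits_cost capped_cost _ 0).trans ?_
  refine funext fun v => congrArg ret (congrArg (LocalSkeleton.mk _) (funext fun u => ?_))
  change skeletonEdge S v u (min (collect S (fun w => H.workerCost edges 128 S w v) u)
    (collect S (fun w => H.workerCost edges 128 S w u) v)) = _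
  by_cases h : v ∈ S ∧ u ∈ S
  · rw [collect_workerCost hsum v h.2, collect_workerCost hsum u h.1, edgeLength]
  · rw [skeletonEdge, skeletonEdge, if_neg (by tauto), if_neg (by tauto)]

end Capped

end HubSystem

theorem HubSystem.IsApprox.localSkeleton_skeleton {n : ℕ} {H : HubSystem (Fin n)}
    {G : WGraph (Fin n)} {α : ℝ≥0∞} {S : Finset (Fin n)} (h : H.IsApprox G α S) (v : Fin n) :
    localSkeleton S h.skeleton v = ⟨decide (v ∈ S),
      fun u => CongestedClique.skeletonEdge S v u (H.edgeLength G.incident v u)⟩ := by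
  classical
  refine congrArg (LocalSkeleton.mk _) (funext fun u => ?_)
  rw [WGraph.incident, CongestedClique.skeletonEdge]
  exact if_congr h.skeleton_adj rfl rfl

namespace CongestedClique

open Program

/-- The indices of the sampling trials. -/
abbrev Trial (n c : ℕ) : Type := Fin c × Fin (Nat.log 2 n + 1)

section Sample

variable {n c : ℕ}

open Classical in
/-- The set `U` together with the nodes whose near sets it misses. -/
noncomputable def cover (N : Fin n → Finset (Fin n)) (U : Finset (Fin n)) : Finset (Fin n) :=
  Finset.univ.filter fun u => u ∈ U ∨ Disjoint (N u) U

/-- The set of the nodes with a positive bit for `τ`. -/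
def trialSet {T : Type} (b : Fin n → T → Bool) (τ : T) : Finset (Fin n) :=
  Finset.univ.filter fun u => b u τ = true

/-- The second component of the trials that node `m` checks. -/
def checkedIndex (m : Fin n) : Fin (Nat.log 2 n + 1) := Fin.ofNat _ m

open Classical in
/-- A trial that was reported as good, when `g m i` is the report of `m` on the trial
`(i, checkedIndex m)`. -/
noncomputable def select (g : Fin n → Fin c → Bool) : Option (Trial n c) :=
  if h : ∃ p : Fin n × Fin c, g p.1 p.2 = true then some (h.choose.2, checkedIndex h.choose.1)
  else none

open Classical in
/-- The choice of a good set, as a program for node `v`, which goes on with `cont`. The trial `τ`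
yields the cover of the random set given by `bits`. A set is judged by itself and by the sum of the
values of `size` at the nodes. -/
noncomputable def sample {Out : Type} (β : ℕ) (near : Finset (Fin n)) (size : Finset (Fin n) → ℕ)
    (good : Finset (Fin n) → ℕ → Prop) (v : Fin n) (bits : Trial n c → Bool)
    (cont : Finset (Fin n) → Program n β Out) : Program n β Out :=
  exchange Set.univ (fun _ => bits) fun b =>
  exchange Set.univ (fun _ τ => bits τ || decide (Disjoint near (trialSet b τ))) fun b' =>
  exchange (Set.univ.pi fun _ => Set.Iic n)
    (fun m i => size (trialSet b' (i, checkedIndex m))) fun cnt =>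
  exchange Set.univ
    (fun _ i => decide (good (trialSet b' (i, checkedIndex v)) (∑ u, cnt u i))) fun g =>
  cont ((select g).elim ∅ (trialSet b'))

@[simp] theorem mem_cover {N : Fin n → Finset (Fin n)} {U : Finset (Fin n)} {u : Fin n} :
    u ∈ cover N U ↔ u ∈ U ∨ Disjoint (N u) U := by simp [cover]

@[simp] theorem mem_trialSet {T : Type} {b : Fin n → T → Bool} {τ : T} {u : Fin n} :
    u ∈ trialSet b τ ↔ b u τ = true := by simp [trialSet]

theorem inter_cover_nonempty {N : Fin n → Finset (Fin n)} {v : Fin n} (hv : v ∈ N v)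
    (U : Finset (Fin n)) : (N v ∩ cover N U).Nonempty := by
  by_cases h : Disjoint (N v) U
  · exact ⟨v, Finset.mem_inter.2 ⟨hv, mem_cover.2 (.inr h)⟩⟩
  · obtain ⟨u, hu, hu'⟩ := Finset.not_disjoint_iff.1 h
    exact ⟨u, Finset.mem_inter.2 ⟨hu, mem_cover.2 (.inl hu')⟩⟩

open Classical in
theorem trialSet_or_disjoint {T : Type} (N : Fin n → Finset (Fin n)) (b : Fin n → T → Bool)
    (τ : T) : trialSet (fun u τ => b u τ || decide (Disjoint (N u) (trialSet b τ))) τ =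
      cover N (trialSet b τ) := by
  ext u
  simp only [mem_trialSet, mem_cover, Bool.or_eq_true, decide_eq_true_iff]

theorem checkedIndex_surjective (hn : 0 < n) :
    Function.Surjective (checkedIndex : Fin n → Fin (Nat.log 2 n + 1)) := fun b =>
  ⟨⟨b, (Nat.lt_succ_iff.1 b.2).trans_lt (Nat.log_lt_self 2 hn.ne')⟩,
    Fin.ext (Nat.mod_eq_of_lt b.2)⟩

theorem exists_select_eq_some (hn : 0 < n) {g : Fin n → Fin c → Bool} {P : Trial n c → Prop}
    (hg : ∀ m i, g m i = true ↔ P (i, checkedIndex m)) (h : ∃ τ, P τ) :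
    ∃ τ, select g = some τ ∧ P τ := by
  obtain ⟨⟨i, b⟩, hb⟩ := h
  obtain ⟨m, rfl⟩ := checkedIndex_surjective hn b
  have h : ∃ p : Fin n × Fin c, g p.1 p.2 = true := ⟨(m, i), (hg m i).2 hb⟩
  exact ⟨_, dif_pos h, (hg _ _).1 h.choose_spec⟩

theorem fits_trial_bool : Fits n c (Set.univ : Set (Trial n c → Bool)) := by
  refine fits_univ (le_of_eq ?_)
  rw [Fintype.card_fun, Fintype.card_bool, Fintype.card_prod, Fintype.card_fin, Fintype.card_fin,
    mul_comm, pow_mul]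

theorem fits_fin_bool : Fits n c (Set.univ : Set (Fin c → Bool)) := by
  refine fits_univ ?_
  rw [Fintype.card_fun, Fintype.card_bool, Fintype.card_fin]
  exact Nat.pow_le_pow_left (two_le_two_pow_log_succ n) c

theorem fits_pi_Iic : Fits n c (Set.univ.pi fun _ : Fin c => Set.Iic n) :=
  ((fits_Iic (b := 1) (by simpa using lt_two_pow_log_succ n)).pi c).mono (by omega)

theorem exists_next_iterate_sample {Out : Type} {β : ℕ} {N : Fin n → Finset (Fin n)}
    {size : Fin n → Finset (Fin n) → ℕ} {good : Finset (Fin n) → ℕ → Prop}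
    {bits : Fin n → Trial n c → Bool} (hn : 0 < n) (hβ : c ≤ β) (hsize : ∀ v S, size v S ≤ n)
    (h : ∃ τ, good (cover N (trialSet bits τ)) (∑ u, size u (cover N (trialSet bits τ))))
    (cont : Fin n → Finset (Fin n) → Program n β Out) :
    ∃ τ, good (cover N (trialSet bits τ)) (∑ u, size u (cover N (trialSet bits τ))) ∧
      next^[4] (fun v => sample β (N v) (size v) good v (bits v) (cont v)) =
        fun v => cont v (cover N (trialSet bits τ)) := by
  classical
  set C : Trial n c → Finset (Fin n) := fun τ => cover N (trialSet bits τ)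
  have trialSet_eq (τ) := trialSet_or_disjoint N bits τ
  obtain ⟨τ, hselect, hgood⟩ := exists_select_eq_some hn
    (g := fun m i => decide (good (C (i, checkedIndex m)) (∑ u, size u (C (i, checkedIndex m)))))
    (fun m i => decide_eq_true_iff) h
  refine ⟨τ, hgood, ?_⟩
  refine (next_iterate_exchange (fits_trial_bool.mono hβ) (fun _ _ => trivial) _ 3).trans <|
    (next_iterate_exchange (fits_trial_bool.mono hβ) (fun _ _ => trivial) _ 2).trans <|
    (next_iterate_exchange (fits_pi_Iic.mono hβ) (fun v _ _ _ => hsize v _) _ 1).trans <|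
    (next_iterate_exchange (fits_fin_bool.mono hβ) (fun _ _ => trivial) _ 0).trans ?_
  funext v
  have hC : trialSet (fun u τ => bits u τ || decide (Disjoint (N u) (trialSet bits τ))) = C :=
    funext trialSet_eq
  refine congrArg (cont v) ?_
  simp only [hC]
  exact congrArg (fun o => Option.elim o ∅ C) hselect

end Sample

section Construct

variable {n c : ℕ}

/-- The construction of the skeleton graph, as a program for node `v`: a set of hubs is sampled,
and the graph is built over it. -/
noncomputable def construct (β M : ℕ) (good : Finset (Fin n) → ℕ → Prop) (v : Fin n)
    (x : LocalInput n × (Trial n c → Bool)) : Program n β (LocalSkeleton n) :=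
  sample β x.1.near (fun S => (x.1.ball M S v).card) good v x.2 fun S =>
    build β M S v (x.1.hub M S v) (x.1.radius M S v) (x.1.ball M S v) (x.1.estimate M) x.1.edges

theorem exists_next_iterate_construct {β M m : ℕ} {good : Finset (Fin n) → ℕ → Prop}
    {I : Fin n → LocalInput n} {bits : Fin n → Trial n c → Bool} (hn : 0 < n) (hM : M ≤ n ^ m)
    (hβ : c + 129 * (m + 6) ≤ β) (hedges : ∀ z y w, (I z).edges y = some w → w ≤ M)
    (hnear : ∀ u, u ∈ (I u).near)
    (hgood : ∀ S t, S.Nonempty → good S t → t ≤ n / S.card * 128 * n)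
    (h : ∃ τ, good (cover (fun u => (I u).near) (trialSet bits τ))
      (∑ u, ((I u).ball M (cover (fun u => (I u).near) (trialSet bits τ)) u).card)) :
    ∃ τ S, S = cover (fun u => (I u).near) (trialSet bits τ) ∧
      good S (∑ u, ((I u).ball M S u).card) ∧
      next^[9] (fun v => construct β M good v (I v, bits v)) = fun v => ret ⟨decide (v ∈ S),
        fun u => skeletonEdge S v u
          ((LocalInput.hubSystem M S I).edgeLength (fun z => (I z).edges) v u)⟩ := by
  obtain ⟨τ, hτ, hsample⟩ := exists_next_iterate_sample hn (by omega : c ≤ β)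
    (size := fun v S => ((I v).ball M S v).card) (fun v S => card_finset_fin_le _) h
    fun v S => build β M S v ((I v).hub M S v) ((I v).radius M S v) ((I v).ball M S v)
      ((I v).estimate M) (I v).edges
  set S := cover (fun u => (I u).near) (trialSet bits τ)
  have hS : S.Nonempty :=
    (inter_cover_nonempty (hnear ⟨0, hn⟩) _).mono Finset.inter_subset_right
  have hsum : ∑ u, ((LocalInput.hubSystem M S I).ball u).card ≤ n / S.card * 128 * n :=
    hgood S _ hS hτ
  refine ⟨τ, S, rfl, hτ, ?_⟩
  have hconstruct : next^[4] (fun v => construct β M good v (I v, bits v)) = fun v =>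
      build β M S v ((I v).hub M S v) ((I v).radius M S v) ((I v).ball M S v)
        ((I v).estimate M) (I v).edges := hsample
  rw [Function.iterate_add_apply next 5 4, hconstruct]
  exact HubSystem.next_iterate_build (H := LocalInput.hubSystem M S I)
    (edges := fun z => (I z).edges) (fun x => (I x).radius_le M S x)
    (fun x z => (I x).estimate_le M z) hedges hM ((Nat.le_add_left _ c).trans hβ) hsum

end Construct

section Extend

variable {n : ℕ}

/-- The extension of distance estimates from the skeleton graph to all nodes, as a program for node
`v`. -/
noncomputable def extend (β M K : ℕ) (v : Fin n)
    (x : LocalInput n × LocalSkeleton n × (Fin n → Option ℝ≥0∞)) :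
    Program n β (Fin n → ℝ≥0∞) :=
  exchange Set.univ (fun _ => x.2.1.isNode) fun b =>
  let S := Finset.univ.filter fun s => b s = true
  exchange (Set.univ ×ˢ Set.Iic M ×ˢ {x | Capped M x})
    (fun u => (x.1.hub M S v, x.1.radius M S v,
      if u ∈ x.1.ball M S v then (x.1.estimate M u : ℕ∞) else ⊤)) fun info =>
  exchange {x | Capped K x} (fun u => (x.2.2 (info u).1).elim ⊤ (roundDown K)) fun D =>
  ret fun u => (min (info u).2.2 (x.1.radius M S v + D (info u).1 + (info u).2.1) : ℕ∞)

theorem next_iterate_extend {β M K m : ℕ} (hM : 4 * M ≤ K) (hK : K ≤ 4 * n ^ m)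
    (hβ : 2 * m + 8 ≤ β) (I : Fin n → LocalInput n) {S : Finset (Fin n)}
    {s : Fin n → LocalSkeleton n} (hs : ∀ v, (s v).isNode = decide (v ∈ S))
    (row : Fin n → Fin n → Option ℝ≥0∞) :
    next^[3] (fun v => extend β M K v (I v, s v, row v)) = fun v => ret fun u =>
      ((LocalInput.hubSystem M S I).extension (fun t t' => (row t t').elim ⊤ (roundDown K)) v u :
        ℝ≥0∞) := by
  have fits_K : Fits n β {x | Capped K x} := (fits_capped hK).mono (by omega)
  have fits_info : Fits n β (Set.univ ×ˢ Set.Iic M ×ˢ {x | Capped M x} : Set (Fin n × ℕ × ℕ∞)) :=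
    ((fits_fin n).prod ((fits_Iic_mul_pow (m := m) (by omega)).prod
      (fits_capped (m := m) (by omega)))).mono (by omega)
  have hfilter : (Finset.univ.filter fun v => (s v).isNode = true) = S := by
    ext v
    simp [hs]
  have info_mem (v u : Fin n) : ((I v).hub M S v, (I v).radius M S v,
      if u ∈ (I v).ball M S v then ((I v).estimate M u : ℕ∞) else ⊤) ∈
        (Set.univ ×ˢ Set.Iic M ×ˢ {x | Capped M x} : Set (Fin n × ℕ × ℕ∞)) := by
    refine ⟨trivial, (I v).radius_le M S v, ?_⟩
    change Capped M (if u ∈ (I v).ball M S v then ((I v).estimate M u : ℕ∞) else ⊤)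
    split_ifs
    exacts [.coe ((I v).estimate_le M u), Or.inl rfl]
  have row_mem (v u : Fin n) :
      (row v ((I u).hub M S u)).elim ⊤ (roundDown K) ∈ {x | Capped K x} := by
    rcases row v ((I u).hub M S u) with _ | x
    exacts [Or.inl rfl, capped_roundDown K x]
  refine (next_iterate_exchange ((fits_bool n).mono (by omega)) (fun _ _ => trivial) _ 2).trans ?_
  simp only [hfilter]
  refine (next_iterate_exchange fits_info info_mem _ 1).trans <|
    (next_iterate_exchange fits_K row_mem _ 0).trans ?_
  rfl

end Extend

end CongestedClique

/-! ### Random hubs -/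

namespace CongestedClique

open scoped BigOperators

section CoinProb

variable {n r : ℕ} {P Q : (Fin n → Fin r → Bool) → Prop}

theorem coinProb_eq_expect [DecidablePred P] :
    coinProb n r P = 𝔼 ω, if P ω then (1 : ℝ) else 0 := by
  rw [Fintype.expect_eq_sum_div_card, Finset.sum_boole, coinProb, Nat.card_eq_fintype_card,
    Nat.card_eq_fintype_card, Fintype.card_subtype]

theorem coinProb_mono (h : ∀ ω, P ω → Q ω) : coinProb n r P ≤ coinProb n r Q := by
  classical
  rw [coinProb_eq_expect, coinProb_eq_expect]
  refine Finset.expect_le_expect fun ω _ => ?_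
  by_cases hP : P ω
  · rw [if_pos hP, if_pos (h ω hP)]
  · rw [if_neg hP]
    positivity

theorem coinProb_nonneg : 0 ≤ coinProb n r P := by
  unfold coinProb
  positivity

theorem coinProb_eq_one (h : ∀ ω, P ω) : coinProb n r P = 1 := by
  classical
  simp [coinProb_eq_expect, h]

theorem coinProb_not : coinProb n r (fun ω => ¬ P ω) = 1 - coinProb n r P := by
  classical
  rw [coinProb_eq_expect, coinProb_eq_expect,
    ← Fintype.expect_const (ι := Fin n → Fin r → Bool) (1 : ℝ), ← Finset.expect_sub_distrib]
  refine Finset.expect_congr rfl fun ω _ => ?_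
  by_cases h : P ω <;> simp [h]

theorem coinProb_or_le :
    coinProb n r (fun ω => P ω ∨ Q ω) ≤ coinProb n r P + coinProb n r Q := by
  classical
  rw [coinProb_eq_expect, coinProb_eq_expect, coinProb_eq_expect, ← Finset.expect_add_distrib]
  refine Finset.expect_le_expect fun ω _ => ?_
  by_cases hP : P ω <;> by_cases hQ : Q ω <;> simp [hP, hQ]

theorem coinProb_lt_le_expect_div {f : (Fin n → Fin r → Bool) → ℝ} (hf : ∀ ω, 0 ≤ f ω) {m : ℝ}
    (hm : 0 < m) : coinProb n r (fun ω => m < f ω) ≤ (𝔼 ω, f ω) / m := by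
  classical
  rw [le_div_iff₀' hm, coinProb_eq_expect, Finset.mul_expect]
  refine Finset.expect_le_expect fun ω _ => ?_
  split_ifs with h
  · simpa using h.le
  · simpa using hf ω

theorem expect_card_filter {α : Type} (A : Finset α) (R : (Fin n → Fin r → Bool) → α → Prop)
    [∀ ω, DecidablePred (R ω)] :
    𝔼 ω, ((A.filter (R ω)).card : ℝ) = ∑ z ∈ A, coinProb n r fun ω => R ω z := by
  simp only [Finset.card_filter, Nat.cast_sum, Nat.cast_ite, Nat.cast_one, Nat.cast_zero]
  rw [Finset.expect_sum_comm]
  exact Finset.sum_congr rfl fun z _ => coinProb_eq_expect.symm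

theorem coinProb_forall_mem (A : Finset (Fin n)) (q : (Fin r → Bool) → Prop) [DecidablePred q] :
    coinProb n r (fun ω => ∀ v ∈ A, q (ω v)) =
      ((Finset.univ.filter q).card / 2 ^ r : ℝ) ^ A.card := by
  have hfilter : (Finset.univ.filter fun ω : Fin n → Fin r → Bool => ∀ v ∈ A, q (ω v)) =
      Fintype.piFinset fun v => if v ∈ A then Finset.univ.filter q else Finset.univ := by
    ext ω
    simp only [Finset.mem_filter, Finset.mem_univ, true_and, Fintype.mem_piFinset]
    refine forall_congr' fun v => ?_
    by_cases hv : v ∈ A <;> simp [hv]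
  have hfactor (v : Fin n) :
      ((if v ∈ A then Finset.univ.filter q else Finset.univ).card / 2 ^ r : ℝ) =
        if v ∈ A then ((Finset.univ.filter q).card / 2 ^ r : ℝ) else 1 := by
    split_ifs
    · rfl
    · simp
  rw [coinProb_eq_expect, Fintype.expect_eq_sum_div_card, Finset.sum_boole, hfilter,
    Fintype.card_piFinset, Fintype.card_fun, Nat.cast_prod]
  simp only [Fintype.card_fun, Fintype.card_bool, Fintype.card_fin, Nat.cast_pow, Nat.cast_ofNat]
  rw [← Fin.prod_const, ← Finset.prod_div_distrib, Finset.prod_congr rfl fun v _ => hfactor v,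
    Fintype.prod_ite_mem, Finset.prod_const]

/-- All random bits as the bits of independent trials. -/
def trialBits {T : Type} {j : ℕ} (e : T × Fin j ≃ Fin r) :
    (Fin n → Fin r → Bool) ≃ (T → Fin n → Fin j → Bool) where
  toFun ω τ v i := ω v (e (τ, i))
  invFun f v x := f (e.symm x).1 v (e.symm x).2
  left_inv ω := by simp
  right_inv f := by simp

theorem coinProb_forall_trialBits {T : Type} [Fintype T] {j : ℕ} (e : T × Fin j ≃ Fin r)
    (q : (Fin n → Fin j → Bool) → Prop) :
    coinProb n r (fun ω => ∀ τ, q (trialBits e ω τ)) = coinProb n j q ^ Fintype.card T := by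
  have hcard : Nat.card {ω : Fin n → Fin r → Bool // ∀ τ, q (trialBits e ω τ)} =
      Nat.card {ξ // q ξ} ^ Fintype.card T := by
    rw [← Nat.card_eq_fintype_card, ← Nat.card_fun]
    exact Nat.card_congr (((trialBits e).subtypeEquiv fun ω => Iff.rfl).trans
      Equiv.subtypePiEquivPi)
  rw [coinProb, coinProb, hcard, Nat.card_congr (trialBits e), Nat.card_fun,
    Nat.card_eq_fintype_card (α := T), div_pow, Nat.cast_pow, Nat.cast_pow]

theorem one_sub_pow_le_coinProb_exists_trialBits {T : Type} [Fintype T] {j : ℕ}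
    (e : T × Fin j ≃ Fin r) {q : (Fin n → Fin j → Bool) → Prop} {x : ℝ}
    (hq : coinProb n j (fun ξ => ¬ q ξ) ≤ x) :
    1 - x ^ Fintype.card T ≤ coinProb n r fun ω => ∃ τ, q (trialBits e ω τ) := by
  have hnone : coinProb n r (fun ω => ¬ ∃ τ, q (trialBits e ω τ)) =
      coinProb n j (fun ξ => ¬ q ξ) ^ Fintype.card T := by
    simp only [not_exists]
    exact coinProb_forall_trialBits e fun ξ => ¬ q ξ
  rw [coinProb_not] at hnone
  have := pow_le_pow_left₀ coinProb_nonneg hq (Fintype.card T)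
  linarith

end CoinProb

section Sampled

variable {n j : ℕ}

/-- The random set of the nodes all of whose bits are positive. -/
def sampled (ξ : Fin n → Fin j → Bool) : Finset (Fin n) :=
  Finset.univ.filter fun v => ∀ i, ξ v i = true

theorem coinProb_disjoint_sampled (A : Finset (Fin n)) :
    coinProb n j (fun ξ => Disjoint A (sampled ξ)) = (1 - 1 / 2 ^ j) ^ A.card := by
  have hfilter : (Finset.univ.filter fun b : Fin j → Bool => ¬ ∀ i, b i = true) =
      Finset.univ.erase fun _ => true := by
    ext b
    simp [funext_iff]
  have hcard : ((Finset.univ.filter fun b : Fin j → Bool => ¬ ∀ i, b i = true).card / 2 ^ j : ℝ) =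
      1 - 1 / 2 ^ j := by
    rw [hfilter, Finset.card_erase_of_mem (Finset.mem_univ _), Finset.card_univ, Fintype.card_fun,
      Fintype.card_bool, Fintype.card_fin, Nat.cast_sub Nat.one_le_two_pow]
    push_cast
    rw [sub_div, div_self (by positivity)]
  rw [← hcard, ← coinProb_forall_mem]
  simp only [Finset.disjoint_left, sampled, Finset.mem_filter, Finset.mem_univ, true_and]

theorem coinProb_mem_sampled (v : Fin n) :
    coinProb n j (fun ξ => v ∈ sampled ξ) = 1 / 2 ^ j := by
  have h := coinProb_disjoint_sampled (j := j) {v}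
  simp only [Finset.disjoint_singleton_left, coinProb_not, Finset.card_singleton, pow_one] at h
  linarith

theorem one_sub_one_div_two_pow_nonneg (j : ℕ) : (0 : ℝ) ≤ 1 - 1 / 2 ^ j := by
  rw [sub_nonneg, div_le_one (by positivity)]
  exact one_le_pow₀ (by norm_num)

theorem expect_card_cover_le {k : ℕ} {N : Fin n → Finset (Fin n)} (hN : ∀ u, k ≤ (N u).card) :
    𝔼 ξ : Fin n → Fin j → Bool, ((cover N (sampled ξ)).card : ℝ) ≤
      n * (1 / 2 ^ j + (1 - 1 / 2 ^ j) ^ k) := by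
  classical
  have hnode (u : Fin n) :
      coinProb n j (fun ξ => u ∈ sampled ξ ∨ Disjoint (N u) (sampled ξ)) ≤
        1 / 2 ^ j + (1 - 1 / 2 ^ j) ^ k := by
    refine coinProb_or_le.trans (add_le_add (coinProb_mem_sampled u).le ?_)
    rw [coinProb_disjoint_sampled]
    exact pow_le_pow_of_le_one (one_sub_one_div_two_pow_nonneg j)
      (sub_le_self 1 (by positivity)) (hN u)
  simp only [cover]
  rw [expect_card_filter]
  refine (Finset.sum_le_card_nsmul _ _ _ fun u _ => hnode u).trans_eq ?_
  rw [Finset.card_univ, Fintype.card_fin, nsmul_eq_mul]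

theorem sum_pow_card_filter_lt {α β R : Type} [LinearOrder β] [CommSemiring R] (A : Finset α)
    {f : α → β} (hf : Function.Injective f) (x : R) :
    ∑ z ∈ A, x ^ (A.filter fun y => f y < f z).card = ∑ i ∈ Finset.range A.card, x ^ i := by
  classical
  induction A using Finset.induction_on_max_value f with
  | empty => simp
  | insert a A ha hmax ih =>
    have hlt (z) (hz : z ∈ A) : f z < f a := (hmax z hz).lt_of_ne fun h => ha (hf h ▸ hz)
    rw [Finset.sum_insert ha, Finset.card_insert_of_notMem ha, Finset.sum_range_succ, ← ih,
      add_comm]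
    congr 1
    · refine Finset.sum_congr rfl fun z hz => ?_
      rw [Finset.filter_insert, if_neg (hlt z hz).not_gt]
    · rw [Finset.filter_insert, if_neg (lt_irrefl _), Finset.filter_true_of_mem hlt]

theorem sum_one_sub_one_div_two_pow_pow_le (j m : ℕ) :
    ∑ i ∈ Finset.range m, (1 - 1 / 2 ^ j : ℝ) ^ i ≤ 2 ^ j := by
  have hgeom := mul_neg_geom_sum (1 - 1 / 2 ^ j : ℝ) m
  rw [sub_sub_cancel] at hgeom
  calc _ = 2 ^ j * (1 / 2 ^ j * ∑ i ∈ Finset.range m, (1 - 1 / 2 ^ j : ℝ) ^ i) := by field_simp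
    _ = 2 ^ j * (1 - (1 - 1 / 2 ^ j) ^ m) := by rw [hgeom]
    _ ≤ 2 ^ j := mul_le_of_le_one_right (by positivity)
      (sub_le_self 1 (pow_nonneg (one_sub_one_div_two_pow_nonneg j) m))

theorem expect_card_ball_le (M : ℕ) (N : Fin n → Finset (Fin n)) (I : LocalInput n) (x : Fin n) :
    𝔼 ξ : Fin n → Fin j → Bool, ((I.ball M (cover N (sampled ξ)) x).card : ℝ) ≤ 2 ^ j := by
  have hball (ξ : Fin n → Fin j → Bool) : I.ball M (cover N (sampled ξ)) x ⊆ I.near.filter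
      fun z => Disjoint (I.near.filter fun y => I.key M y < I.key M z) (sampled ξ) := by
    intro z hz
    obtain ⟨hz, hle⟩ := Finset.mem_filter.1 hz
    refine Finset.mem_filter.2 ⟨hz, Finset.disjoint_left.2 fun y hy hyξ => ?_⟩
    obtain ⟨hy, hlt⟩ := Finset.mem_filter.1 hy
    exact (hlt.trans_le hle).not_ge (LocalInput.key_hub_le x hy (mem_cover.2 (.inl hyξ)))
  calc _ ≤ 𝔼 ξ : Fin n → Fin j → Bool, ((I.near.filter fun z =>
        Disjoint (I.near.filter fun y => I.key M y < I.key M z) (sampled ξ)).card : ℝ) :=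
        Finset.expect_le_expect fun ξ _ => by exact_mod_cast Finset.card_le_card (hball ξ)
    _ = ∑ i ∈ Finset.range I.near.card, (1 - 1 / 2 ^ j : ℝ) ^ i := by
        rw [expect_card_filter, ← sum_pow_card_filter_lt I.near (I.key_injective M)]
        exact Finset.sum_congr rfl fun z _ => coinProb_disjoint_sampled _
    _ ≤ 2 ^ j := sum_one_sub_one_div_two_pow_pow_le j _

end Sampled

section Good

variable {n k : ℕ}

/-- The requirements on a set of hubs `S` whose balls have total size `t`. The second one leaves the
hubs enough nodes to collect the contents of all balls. -/
def IsGood (n k : ℕ) (S : Finset (Fin n)) (t : ℕ) : Prop :=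
  (S.card : ℝ) ≤ 12 * (n * Real.log (k + 1) / k) ∧ (t : ℝ) ≤ 4 * (n * k / Real.log (k + 1))

theorem log_add_one_pos (hk : 0 < k) : 0 < Real.log (k + 1) :=
  Real.log_pos (lt_add_of_pos_left 1 (Nat.cast_pos.2 hk))

theorem log_add_one_div_le_one (k : ℕ) : Real.log (k + 1) / k ≤ 1 := by
  refine div_le_one_of_le₀ ?_ k.cast_nonneg
  have := Real.log_le_sub_one_of_pos (x := (k : ℝ) + 1) (by positivity)
  linarith

theorem one_sub_pow_le_log_add_one_div (hk : 0 < k) {x : ℝ} (hx : Real.log (k + 1) / k ≤ x)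
    (hx1 : x ≤ 1) : (1 - x) ^ k ≤ Real.log (k + 1) / k := by
  have hlog : 1 - (k + 1 : ℝ)⁻¹ ≤ Real.log (k + 1) :=
    Real.one_sub_inv_le_log_of_pos (by positivity)
  calc (1 - x) ^ k ≤ Real.exp (-(Real.log (k + 1) / k)) ^ k :=
        pow_le_pow_left₀ (sub_nonneg.2 hx1)
          ((sub_le_sub_left hx 1).trans (Real.one_sub_le_exp_neg _)) k
    _ = (k + 1 : ℝ)⁻¹ := by
        rw [← Real.exp_nat_mul, mul_neg, mul_div_cancel₀ _ (by positivity), Real.exp_neg,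
          Real.exp_log (by positivity)]
    _ = (1 - (k + 1 : ℝ)⁻¹) / k := by field_simp; ring
    _ ≤ _ := by gcongr

theorem exists_one_div_two_pow_mem_Icc {q : ℝ} (hq : 0 < q) (hq1 : q ≤ 1) :
    ∃ j : ℕ, (1 / 2 ^ j : ℝ) ∈ Set.Icc q (2 * q) := by
  obtain ⟨j, hle, hlt⟩ := exists_nat_pow_near (one_le_one_div hq hq1) (one_lt_two (α := ℝ))
  refine ⟨j, (le_one_div (by positivity) hq).1 hle, ?_⟩
  rw [one_div_lt hq (by positivity), pow_succ] at hlt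
  calc (1 / 2 ^ j : ℝ) = 2 * (1 / (2 ^ j * 2)) := by field_simp
    _ ≤ 2 * q := by gcongr

theorem coinProb_not_isGood_le {j : ℕ} (hn : 0 < n) (hk : 0 < k)
    (hj : (1 / 2 ^ j : ℝ) ∈ Set.Icc (Real.log (k + 1) / k) (2 * (Real.log (k + 1) / k))) (M : ℕ)
    {I : Fin n → LocalInput n} (hI : ∀ u, k ≤ (I u).near.card) :
    coinProb n j (fun ξ => ¬ IsGood n k (cover (fun u => (I u).near) (sampled ξ))
      (∑ u, ((I u).ball M (cover (fun u => (I u).near) (sampled ξ)) u).card)) ≤ 1 / 2 := by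
  set S := fun ξ : Fin n → Fin j → Bool => cover (fun u => (I u).near) (sampled ξ)
  set t := fun ξ => ∑ u, ((I u).ball M (S ξ) u).card
  have hlog := log_add_one_pos hk
  have hcard : 𝔼 ξ, ((S ξ).card : ℝ) ≤ 12 * (n * Real.log (k + 1) / k) / 4 := by
    have hmiss : (1 - 1 / 2 ^ j : ℝ) ^ k ≤ Real.log (k + 1) / k :=
      one_sub_pow_le_log_add_one_div hk hj.1 (sub_nonneg.1 (one_sub_one_div_two_pow_nonneg j))
    calc _ ≤ n * (1 / 2 ^ j + (1 - 1 / 2 ^ j) ^ k : ℝ) := expect_card_cover_le hI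
      _ ≤ n * (2 * (Real.log (k + 1) / k) + Real.log (k + 1) / k) := by
        gcongr
        exact hj.2
      _ = _ := by ring
  have htotal : 𝔼 ξ, (t ξ : ℝ) ≤ 4 * (n * k / Real.log (k + 1)) / 4 := by
    have hpow : (2 ^ j : ℝ) ≤ k / Real.log (k + 1) := by
      simpa using one_div_le_one_div_of_le (by positivity) hj.1
    calc _ = ∑ u, 𝔼 ξ, (((I u).ball M (S ξ) u).card : ℝ) := by
          simp only [t, Nat.cast_sum, Finset.expect_sum_comm]
      _ ≤ ∑ _u : Fin n, (2 ^ j : ℝ) := Finset.sum_le_sum fun u _ => expect_card_ball_le M _ (I u) u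
      _ = n * 2 ^ j := by simp
      _ ≤ n * (k / Real.log (k + 1)) := by gcongr
      _ = _ := by ring
  have hbad : ∀ ξ, ¬ IsGood n k (S ξ) (t ξ) →
      12 * (n * Real.log (k + 1) / k) < (S ξ).card ∨ 4 * (n * k / Real.log (k + 1)) < t ξ :=
    fun ξ h => by simpa only [IsGood, not_and_or, not_le] using h
  calc _ ≤ _ := coinProb_mono hbad
    _ ≤ _ := coinProb_or_le
    _ ≤ 1 / 4 + 1 / 4 := add_le_add
      ((coinProb_lt_le_expect_div (fun _ => Nat.cast_nonneg _) (by positivity)).trans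
        ((div_le_iff₀ (by positivity)).2 (by linarith)))
      ((coinProb_lt_le_expect_div (fun _ => Nat.cast_nonneg _) (by positivity)).trans
        ((div_le_iff₀ (by positivity)).2 (by linarith)))
    _ = 1 / 2 := by norm_num

theorem IsGood.card_mul_le (hk : 0 < k) {S : Finset (Fin n)} {t : ℕ} (h : IsGood n k S t) :
    S.card * t ≤ 48 * n * n := by
  have hlog := log_add_one_pos hk
  have hmul : (S.card * t : ℝ) ≤ 48 * n * n := calc
    _ ≤ 12 * (n * Real.log (k + 1) / k) * (4 * (n * k / Real.log (k + 1))) :=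
      mul_le_mul h.1 h.2 (by positivity) (by positivity)
    _ = 48 * n * n := by field_simp; ring
  exact_mod_cast hmul

theorem IsGood.le_div_card_mul (hk : 0 < k) {S : Finset (Fin n)} {t : ℕ} (h : IsGood n k S t)
    (hS : S.Nonempty) : t ≤ n / S.card * 128 * n := by
  have hdiv : n ≤ 2 * (n / S.card) * S.card := by
    have hquot : 1 ≤ n / S.card := (Nat.one_le_div_iff hS.card_pos).2 (card_finset_fin_le S)
    have hmod := Nat.lt_div_mul_add hS.card_pos (a := n)
    nlinarith
  refine Nat.le_of_mul_le_mul_left ((h.card_mul_le hk).trans ?_) hS.card_pos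
  calc 48 * n * n ≤ 64 * n * (2 * (n / S.card) * S.card) := by gcongr; norm_num
    _ = S.card * (n / S.card * 128 * n) := by ring

theorem one_half_pow_card_trial_le (c : ℕ) (hn : 0 < n) :
    (1 / 2 : ℝ) ^ Fintype.card (Trial n c) ≤ 1 / (n : ℝ) ^ c := by
  rw [Fintype.card_prod, Fintype.card_fin, Fintype.card_fin, one_div_pow, mul_comm, pow_mul]
  refine one_div_le_one_div_of_le (by positivity) (pow_le_pow_left₀ (by positivity) ?_ c)
  exact_mod_cast (lt_two_pow_log_succ n).le

end Good

end CongestedClique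

/-! ### The two algorithms -/

theorem WGraph.weightsLE_pow_add_two {n m : ℕ} {G : WGraph (Fin n)}
    (h : G.WeightsLE (4 * n ^ m)) : G.WeightsLE (n ^ (m + 2)) := by
  rintro ⟨u, v⟩ huv
  have : Nontrivial (Fin n) := ⟨u, v, G.graph.ne_of_adj huv⟩
  have hn : 2 ≤ n := Fin.nontrivial_iff_two_le.1 this
  calc G.weight s(u, v) ≤ 2 ^ 2 * n ^ m := h _ huv
    _ ≤ n ^ 2 * n ^ m := by gcongr
    _ = n ^ (m + 2) := by rw [← pow_add, add_comm]

namespace CongestedClique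

open Program

section Algorithms

variable {n p c k r j : ℕ} {G : WGraph (Fin n)} {a : ℝ} {δ : Fin n → Fin n → ℤ}
  {N : Fin n → Finset (Fin n)} {S : Finset (Fin n)}

noncomputable instance : Inhabited (LocalSkeleton n) := ⟨⟨false, fun _ => none⟩⟩

/-- The randomized construction of the skeleton graph. The enumeration `e` determines which random
bits of a node form its bits in a trial. -/
noncomputable def skeletonAlgorithm (p k : ℕ) (e : Trial n c × Fin j ≃ Fin r) :
    Algorithm n (c + 129 * (p + 8)) (LocalInput n × (Fin r → Bool)) (LocalSkeleton n) :=
  toAlgorithm fun v x =>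
    construct _ (n ^ (p + 1)) (IsGood n k) v (x.1, fun τ => decide (∀ i, x.2 (e (τ, i)) = true))

/-- The deterministic computation of approximate distances from those on the skeleton graph. -/
noncomputable def extensionAlgorithm (n p c : ℕ) : Algorithm n (c + 129 * (p + 8))
    (LocalInput n × LocalSkeleton n × (Fin n → Option ℝ≥0∞)) (Fin n → ℝ≥0∞) :=
  toAlgorithm fun v x => extend _ (n ^ (p + 1)) (4 * n ^ (p + 2)) v x

theorem trialSet_decide (e : Trial n c × Fin j ≃ Fin r) (ω : Fin n → Fin r → Bool)
    (τ : Trial n c) : trialSet (fun v τ => decide (∀ i, ω v (e (τ, i)) = true)) τ =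
      sampled (trialBits e ω τ) := by
  ext v
  rw [mem_trialSet, decide_eq_true_iff, sampled, Finset.mem_filter_univ]
  rfl

theorem capped_dist_of_weightsLE_pow {q m : ℕ} (hG : G.WeightsLE (q * n ^ m)) (u v : Fin n) :
    Capped (q * n ^ (m + 1)) (G.dist u v) := by
  have h := WGraph.capped_dist hG u v
  rwa [Fintype.card_fin, mul_left_comm, ← pow_succ'] at h

theorem exists_run_skeletonAlgorithm (hn : 0 < n) (hk : 0 < k) (e : Trial n c × Fin j ≃ Fin r)
    (hG : G.WeightsLE (n ^ p)) (h : IsLocalApprox G a δ N) (hN : ∀ u, (N u).Nonempty)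
    {ω : Fin n → Fin r → Bool}
    (hω : ∃ τ, IsGood n k (cover N (sampled (trialBits e ω τ))) (∑ u, ((localInput G δ N u).ball
      (n ^ (p + 1)) (cover N (sampled (trialBits e ω τ))) u).card)) :
    ∃ (S : Finset (Fin n))
      (hS : (LocalInput.hubSystem (n ^ (p + 1)) S (localInput G δ N)).IsApprox G
        (ENNReal.ofReal a) S),
      (S.card : ℝ) ≤ 12 * (n * Real.log (k + 1) / k) ∧
        (skeletonAlgorithm p k e).run 9 (fun u => (localInput G δ N u, ω u)) =
          localSkeleton S hS.skeleton := by
  have hedges (z y : Fin n) (w : ℕ) (hw : (localInput G δ N z).edges y = some w) :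
      w ≤ n ^ (p + 1) := by
    obtain ⟨hzy, rfl⟩ := WGraph.incident_eq_some_iff.1 hw
    exact (hG _ hzy).trans (Nat.pow_le_pow_right hn p.le_succ)
  simp only [← trialSet_decide] at hω
  obtain ⟨τ, S, hS, hgood, hnext⟩ := exists_next_iterate_construct hn le_rfl
    (by omega : c + 129 * (p + 1 + 6) ≤ c + 129 * (p + 8)) hedges (fun u => h.self_mem (hN u))
    (fun S t hS hgood => hgood.le_div_card_mul hk hS) hω
  have hM (u v : Fin n) : Capped (n ^ (p + 1)) (G.dist u v) := by
    simpa only [one_mul] using capped_dist_of_weightsLE_pow (q := 1) (by rwa [one_mul]) u v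
  refine ⟨S, h.isApprox_hubSystem hM fun x => hS ▸ inter_cover_nonempty (h.self_mem (hN x)) _,
    hgood.1, (run_toAlgorithm hnext).trans (funext fun v => ?_)⟩
  exact (HubSystem.IsApprox.localSkeleton_skeleton _ v).symm

theorem isApproxOn_run_extensionAlgorithm (ha : 1 ≤ a) (hG : G.WeightsLE (n ^ (p + 1)))
    (h : (LocalInput.hubSystem (n ^ (p + 1)) S (localInput G δ N)).IsApprox G
      (ENNReal.ofReal a) S) {l : ℝ} (hl : 1 ≤ l) {D : Fin n → Fin n → ℝ≥0∞}
    (hD : IsApproxOn S l h.skeleton.dist D) :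
    IsApproxOn Finset.univ (7 * l * a ^ 2) G.dist ((extensionAlgorithm n p c).run 3
      fun u => (localInput G δ N u, localSkeleton S h.skeleton u, distRow S D u)) := by
  have hskeleton : h.skeleton.WeightsLE (4 * n ^ (p + 1)) := h.skeleton_weightsLE hG
    (fun x => LocalInput.radius_le _ _ S x) (fun x => LocalInput.estimate_le _ _)
  have hrow : IsApproxOn S l h.skeleton.dist
      fun s t => ((distRow S D s t).elim ⊤ (roundDown (4 * n ^ (p + 2))) : ℕ∞) := by
    intro s hs t ht
    have hst : distRow S D s t = some (D s t) := if_pos ⟨hs, ht⟩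
    simpa only [hst, Option.elim_some] using
      hD.roundDown (capped_dist_of_weightsLE_pow hskeleton) s hs t ht
  have hM : 4 * n ^ (p + 1) ≤ 4 * n ^ (p + 2) := by
    rcases n.eq_zero_or_pos with rfl | hn
    · simp
    · exact Nat.mul_le_mul_left 4 (Nat.pow_le_pow_right hn (p + 1).le_succ)
  have hnext := next_iterate_extend hM le_rfl (by omega : 2 * (p + 2) + 8 ≤ c + 129 * (p + 8))
    (localInput G δ N) (s := localSkeleton S h.skeleton) (fun _ => rfl) (distRow S D)
  have hrun : (extensionAlgorithm n p c).run 3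
      (fun u => (localInput G δ N u, localSkeleton S h.skeleton u, distRow S D u)) = _ :=
    run_toAlgorithm hnext
  rw [hrun]
  exact h.isApproxOn_extension ha hl hrow

end Algorithms

end CongestedClique

open CongestedClique in
theorem lemma6p1_general (p c n k : ℕ) (hk : 1 ≤ k) :
    ∃ (r : ℕ)
      (A : CongestedClique.Algorithm n (c + 129 * (p + 8)) (LocalInput n × (Fin r → Bool))
        (LocalSkeleton n))
      (B : CongestedClique.Algorithm n (c + 129 * (p + 8))
        (LocalInput n × LocalSkeleton n × (Fin n → Option ℝ≥0∞)) (Fin n → ℝ≥0∞)),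
      ∀ G : WGraph (Fin n), G.WeightsLE (n ^ p) →
      ∀ a : ℝ, 1 ≤ a →
      ∀ δ : Fin n → Fin n → ℤ,
      ∀ N : Fin n → Finset (Fin n), (∀ u, k ≤ (N u).card) →
      IsLocalApprox G a δ N →
      1 - 1 / (n : ℝ) ^ c ≤ CongestedClique.coinProb n r (fun ω =>
        ∃ (S : Finset (Fin n)) (H : WGraph (Fin n)),
          (∀ v, A.run 9 (fun u => (localInput G δ N u, ω u)) v = localSkeleton S H v) ∧
          H.IsOver S ∧
          H.WeightsLE (n ^ (p + 3)) ∧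
          (S.card : ℝ) ≤ 12 * (n * Real.log (k + 1) / k) ∧
          ∀ l : ℝ, 1 ≤ l →
          ∀ D : Fin n → Fin n → ℝ≥0∞, IsApproxOn S l H.dist D →
            IsApproxOn Finset.univ (7 * l * a ^ 2) G.dist
              (B.run 3 (fun u => (localInput G δ N u, localSkeleton S H u, distRow S D u)))) := by
  obtain ⟨j, hj⟩ := exists_one_div_two_pow_mem_Icc
    (div_pos (log_add_one_pos hk) (Nat.cast_pos.2 hk)) (log_add_one_div_le_one k)
  let e := Fintype.equivFin (Trial n c × Fin j)
  refine ⟨_, skeletonAlgorithm p k e, extensionAlgorithm n p c, fun G hG a ha δ N hN h => ?_⟩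
  rcases n.eq_zero_or_pos with rfl | hn
  · rw [coinProb_eq_one fun ω => ⟨∅, G, finZeroElim, finZeroElim, Sym2.ind finZeroElim, by simp,
      fun _ _ _ _ => finZeroElim⟩]
    exact sub_le_self 1 (by positivity)
  have hGM : G.WeightsLE (n ^ (p + 1)) :=
    fun e he => (hG e he).trans (Nat.pow_le_pow_right hn p.le_succ)
  calc 1 - 1 / (n : ℝ) ^ c ≤ 1 - (1 / 2) ^ Fintype.card (Trial n c) :=
        sub_le_sub_left (one_half_pow_card_trial_le c hn) 1
    _ ≤ _ := one_sub_pow_le_coinProb_exists_trialBits e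
        (coinProb_not_isGood_le hn hk hj (n ^ (p + 1)) (I := localInput G δ N) hN)
    _ ≤ _ := coinProb_mono fun ω hω => by
        obtain ⟨S, hS, hcard, hrun⟩ := exists_run_skeletonAlgorithm hn hk e hG h
          (fun u => Finset.card_pos.1 (hk.trans (hN u))) hω
        exact ⟨S, hS.skeleton, congrFun hrun, hS.skeleton_isOver,
          WGraph.weightsLE_pow_add_two (hS.skeleton_weightsLE hGM
            (fun x => LocalInput.radius_le _ _ S x) (fun x => LocalInput.estimate_le _ _)),
          hcard, fun l hl D hD => isApproxOn_run_extensionAlgorithm ha hGM hS hl hD⟩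

/-- `C` is the constant in the size of the skeleton graph. For edge weights at most `n ^ p` and
failure probability at most `1 / n ^ c`, messages have `O(β log n)` bits, the skeleton graph has
weights at most `n ^ q`, the randomized construction `A` takes `R₁` rounds and the deterministic
extension `B` takes `R₂` rounds. The algorithms depend on `n` and `k` only. -/
theorem lemma6p1 :
    ∃ C : ℝ, ∀ p c : ℕ, ∃ β q R₁ R₂ : ℕ, ∀ n k : ℕ, 1 ≤ k →
      ∃ (r : ℕ)
        (A : CongestedClique.Algorithm n β (LocalInput n × (Fin r → Bool)) (LocalSkeleton n))
        (B : CongestedClique.Algorithm n β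
          (LocalInput n × LocalSkeleton n × (Fin n → Option ℝ≥0∞)) (Fin n → ℝ≥0∞)),
        ∀ G : WGraph (Fin n), G.WeightsLE (n ^ p) →
        ∀ a : ℝ, 1 ≤ a →
        ∀ δ : Fin n → Fin n → ℤ, (∀ u v, δ u v = δ v u) →
        ∀ N : Fin n → Finset (Fin n), (∀ u, (N u).card = k) →
        IsLocalApprox G a δ N →
        1 - 1 / (n : ℝ) ^ c ≤ CongestedClique.coinProb n r (fun ω =>
          ∃ (S : Finset (Fin n)) (H : WGraph (Fin n)),
            (∀ v, A.run R₁ (fun u => (localInput G δ N u, ω u)) v = localSkeleton S H v) ∧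
            H.IsOver S ∧
            H.WeightsLE (n ^ q) ∧
            (S.card : ℝ) ≤ C * (n * Real.log (k + 1) / k) ∧
            ∀ l : ℝ, 1 ≤ l →
            ∀ D : Fin n → Fin n → ℝ≥0∞, IsApproxOn S l H.dist D →
              IsApproxOn Finset.univ (7 * l * a ^ 2) G.dist
                (B.run R₂ (fun u => (localInput G δ N u, localSkeleton S H u, distRow S D u)))) :=
  ⟨12, fun p c => ⟨_, p + 3, 9, 3, fun n k hk =>
    let ⟨r, A, B, h⟩ := lemma6p1_general p c n k hk
    ⟨r, A, B, fun G hG a ha δ _ N hN => h G hG a ha δ N fun u => (hN u).ge⟩⟩⟩
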